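/- **Setting.** Let $Var$ be a countably infinite set of quantum variables, each of type Boolean (state space $\mathcal H_2$ with orthonormal basis $|0\rangle,|1\rangle$) or integer (state space $\ell^2(\mathbb Z)$ with orthonormal basis $|n\rangle$, $n\in\mathbb Z$). $\mathcal H_{\rm all}$ is the Hilbert space having as orthonormal basis the countably many product vectors $\bigotimes_q|c_q\rangle$ with $c_q=0$ for all but finitely many $q$. For a register $\overline q=q_1,\dots,q_n$ of distinct variables, $\mathcal H_{\overline q}=\bigotimes_i\mathcal H_{q_i}$; a bounded operator $A$ on $\mathcal H_{\overline q}$ is also read as its extension $A\otimes I$ to $\mathcal H_{\rm all}$, and $|a\rangle_q\langle b|$ denotes the extension of $|a\rangle\langle b|$ on $\mathcal H_q$. $\sqsubseteq$ is the Löwner order ($A\sqsubseteq B$ iff $B-A$ is positive). $\mathcal D^-$ is the set of positive operators $\rho$ on $\mathcal H_{\rm all}$ of finite trace with $tr(\rho)\le 1$; a quantum predicate is an operator $P$ on $\mathcal H_{\rm all}$ with $0\sqsubseteq P\sqsubseteq I$. Programs are generated by $$S::=\mathbf{skip}\mid q:=0\mid \overline q:=U\overline q\mid S_1;S_2\mid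 \mathbf{measure}\ M[\overline q]:\overline S\mid \mathbf{while}\ M[\overline q]=1\ \mathbf{do}\ S,$$ where $U^\dagger U=I$ on $\mathcal H_{\overline q}$; $M=\{M_m\}$ is a (possibly infinite) family of bounded operators on $\mathcal H_{\overline q}$ with $\sum_m M_m^\dagger M_m=I$ strongly, $\overline S=\{S_m\}$ contains one program for each outcome $m$, and $M=\{M_0,M_1\}$ in a loop. With $E$ the empty program and $E;S_2=S_2$, the transitions are $\langle\mathbf{skip},\rho\rangle\to\langle E,\rho\rangle$; $\langle q:=0,\rho\rangle\to\langle E,\sum_n|0\rangle_q\langle n|\rho|n\rangle_q\langle 0|\rangle$ ($n$ ranging over $\{0,1\}$ or $\mathbb Z$ according to $type(q)$); $\langle\overline q:=U\overline q,\rho\rangle\to\langle E,U\rho U^\dagger\rangle$; $\langle S_1;S_2,\rho\rangle\to\langle S_1';S_2,\rho'\rangle$ whenever $\langle S_1,\rho\rangle\to\langle S_1',\rho'\rangle$; $\langle\mathbf{measure}\ M[\overline q]:\overline S,\rho\rangle\to\langle S_m,M_m\rho M_m^\dagger\rangle$ for each outcome $m$; and, for $W=\mathbf{while}\ M[\overline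 q]=1\ \mathbf{do}\ S$, $\langle W,\rho\rangle\to\langle E,M_0\rho M_0^\dagger\rangle$ and $\langle W,\rho\rangle\to\langle S;W,M_1\rho M_1^\dagger\rangle$. $[\![S]\!](\rho)$ is the sum of the $\rho'$ over all terminating computations $\langle S,\rho\rangle\to^*\langle E,\rho'\rangle$, counted with multiplicity (distinct outcomes give distinct transitions). $\models_{\rm par}\{P\}S\{Q\}$ means $tr(P\rho)\le tr(Q[\![S]\!](\rho))+[tr(\rho)-tr([\![S]\!](\rho))]$ for all $\rho\in\mathcal D^-$. The weakest liberal precondition $wlp.S.P$ is the quantum predicate such that $\models_{\rm par}\{wlp.S.P\}S\{P\}$, and $Q\sqsubseteq wlp.S.P$ for every quantum predicate $Q$ with $\models_{\rm par}\{Q\}S\{P\}$. **Proposition.** For every program $S$ and quantum predicate $P$, $wlp.S.P$ exists and is unique. Moreover: 1. For all programs, registers, operators and quantum predicates $P$ as above: (a) $wlp.\mathbf{skip}.P=P$. (b) If $type(q)$ is Boolean, $wlp.(q:=0).P=|0\rangle_q\langle0|P|0\rangle_q\langle0|+|1\rangle_q\langle0|P|0\rangle_q\langle1|$; if $type(q)$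 is integer, $wlp.(q:=0).P=\sum_{n=-\infty}^{\infty}|n\rangle_q\langle0|P|0\rangle_q\langle n|$, the sum converging strongly. (c) $wlp.(\overline q:=U\overline q).P=U^\dagger PU$. (d) $wlp.(S_1;S_2).P=wlp.S_1.(wlp.S_2.P)$. (e) $wlp.(\mathbf{measure}\ M[\overline q]:\overline S).P=\sum_m M_m^\dagger(wlp.S_m.P)M_m$, the sum converging strongly. (f) $wlp.(\mathbf{while}\ M[\overline q]=1\ \mathbf{do}\ S).P=\bigwedge_{n=0}^\infty P_n$, the greatest lower bound in the Löwner order, where $P_0=I$ and $P_{n+1}=M_0^\dagger PM_0+M_1^\dagger(wlp.S.P_n)M_1$; here $(P_n)$ is a decreasing sequence of quantum predicates. 2. For every program $S$, quantum predicate $P$ and $\rho\in\mathcal D^-$, $$tr((wlp.S.P)\rho)=tr(P[\![S]\!](\rho))+[tr(\rho)-tr([\![S]\!](\rho))].$$ -/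

import Mathlib

open scoped InnerProduct

noncomputable section

namespace QuantumProg

universe u

/-! ## Types, values and state spaces -/

/-- The two basic types of quantum variables. -/
inductive QType : Type
  | boolean
  | integer

/-- The labels of the computational basis of the Hilbert space denoted by a type. -/
def Val : QType → Type
  | .boolean => Fin 2
  | .integer => ℤ

instance instZeroVal : (t : QType) → Zero (Val t)
  | .boolean => inferInstanceAs (Zero (Fin 2))
  | .integer => inferInstanceAs (Zero ℤ)

instance instOneVal : (t : QType) → One (Val t)
  | .boolean => inferInstanceAs (One (Fin 2))
  | .integer => inferInstanceAs (One ℤ)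

/-- The Hilbert space of square summable families indexed by `X`;
its computational basis is indexed by `X`. -/
abbrev L2 (X : Type u) : Type u := lp (fun _ : X => ℂ) 2

open Classical in
/-- The vector `|x⟩` of the computational basis. -/
def ket {X : Type u} (x : X) : L2 X := lp.single 2 x (1 : ℂ)

lemma inner_ket {X : Type u} (x : X) (ψ : L2 X) : inner ℂ (ket x) ψ = ψ x := by
  classical
  simp [ket, lp.inner_single_left]

lemma ket_apply_self {X : Type u} (x : X) : ket x x = 1 := by
  simp [ket]

lemma ket_apply_ne {X : Type u} {x y : X} (h : y ≠ x) : ket x y = 0 := by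
  simp [ket, h]

lemma L2.hasSum_norm_sq {X : Type u} (ψ : L2 X) : HasSum (fun x => ‖ψ x‖ ^ 2) (‖ψ‖ ^ 2) := by
  have h := lp.hasSum_norm (p := 2) (by norm_num) ψ
  simpa using h

lemma L2.memℓp_of_summable {X : Type u} {f : X → ℂ} (h : Summable fun x => ‖f x‖ ^ 2) :
    Memℓp f 2 := by
  refine memℓp_gen ?_
  simpa using h

variable {Var : Type u} (ty : Var → QType)

/-- Global basis configurations: a value for each quantum variable, all but finitely many
being `0`. -/
def Conf : Type u := {c : (q : Var) → Val (ty q) // {q | c q ≠ 0}.Finite}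

/-- The state space of all quantum variables: the Hilbert space whose orthonormal basis consists
of the product vectors `⨂ |c q⟩` for `c : Conf ty`, a countable set when `Var` is countable. -/
abbrev Hall : Type u := L2 (Conf ty)

/-- Bounded operators on the global state space. -/
abbrev Op : Type u := Hall ty →L[ℂ] Hall ty

variable {ty}

/-- Basis labels of a quantum register, i.e. a finite sequence `r` of distinct variables. -/
abbrev RegVal (ty : Var → QType) {n : ℕ} (r : Fin n ↪ Var) : Type := (i : Fin n) → Val (ty (r i))

/-- The state space of a quantum register: the tensor product of the spaces of its variables. -/
abbrev RegSpace (ty : Var → QType) {n : ℕ} (r : Fin n ↪ Var) : Type := L2 (RegVal ty r)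

/-- Bounded operators on the state space of a register. -/
abbrev RegOp (ty : Var → QType) {n : ℕ} (r : Fin n ↪ Var) : Type :=
  RegSpace ty r →L[ℂ] RegSpace ty r

/-! ## Cylinder extension -/

section Cylinder

variable {n : ℕ} (r : Fin n ↪ Var)

/-- The values that a global configuration gives to the register. -/
def Conf.restrict (c : Conf ty) : RegVal ty r := fun i => c.1 (r i)

open Classical in
/-- The function `c` with its values on the register replaced by `x`. -/
def overrideFun (c : (q : Var) → Val (ty q)) (x : RegVal ty r) (q : Var) : Val (ty q) :=
  if h : ∃ i, r i = q then h.choose_spec ▸ x h.choose else c q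

lemma overrideFun_mem (c : (q : Var) → Val (ty q)) (x : RegVal ty r) (i : Fin n) :
    overrideFun r c x (r i) = x i := by
  have h : ∃ j, r j = r i := ⟨i, rfl⟩
  unfold overrideFun
  rw [dif_pos h]
  have key : ∀ (j : Fin n) (e : r j = r i), (e ▸ x j : Val (ty (r i))) = x i := by
    intro j e
    obtain rfl : j = i := r.injective e
    rfl
  exact key _ _

lemma overrideFun_not_mem (c : (q : Var) → Val (ty q)) (x : RegVal ty r) {q : Var}
    (h : ¬ ∃ i, r i = q) : overrideFun r c x q = c q := by
  unfold overrideFun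
  rw [dif_neg h]

/-- The configuration `c` with its values on the register replaced by `x`. -/
def Conf.override (c : Conf ty) (x : RegVal ty r) : Conf ty :=
  ⟨overrideFun r c.1 x, by
    refine (c.2.union (Set.finite_range r)).subset ?_
    intro q hq
    by_cases h : ∃ i, r i = q
    · exact Or.inr h
    · left
      rw [Set.mem_ofPred_eq, overrideFun_not_mem r _ _ h] at hq
      exact hq⟩

lemma Conf.restrict_override (c : Conf ty) (x : RegVal ty r) :
    (c.override r x).restrict r = x :=
  funext fun i => overrideFun_mem r c.1 x i

lemma Conf.ext_of {c d : Conf ty} (h₁ : c.restrict r = d.restrict r)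
    (h₂ : ∀ q, (¬ ∃ i, r i = q) → c.1 q = d.1 q) : c = d := by
  apply Subtype.ext
  funext q
  by_cases h : ∃ i, r i = q
  · obtain ⟨i, rfl⟩ := h
    exact congrFun h₁ i
  · exact h₂ q h

lemma Conf.override_override (c : Conf ty) (x y : RegVal ty r) :
    (c.override r x).override r y = c.override r y := by
  apply Conf.ext_of r
  · rw [Conf.restrict_override, Conf.restrict_override]
  · intro q h
    change overrideFun r _ _ q = overrideFun r _ _ q
    rw [overrideFun_not_mem r _ _ h, overrideFun_not_mem r _ _ h]
    exact overrideFun_not_mem r _ _ h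

lemma Conf.override_restrict (c : Conf ty) : c.override r (c.restrict r) = c := by
  apply Conf.ext_of r
  · rw [Conf.restrict_override]
  · intro q h
    exact overrideFun_not_mem r _ _ h

lemma Conf.override_injective (c : Conf ty) : Function.Injective (c.override r) := fun x y h => by
  rw [← Conf.restrict_override r c x, h, Conf.restrict_override]

/-- Splitting a configuration into its part on the register and its part off the register
(represented by a configuration that is `0` on the register). -/
def Conf.split : Conf ty ≃ {c : Conf ty // c.restrict r = 0} × RegVal ty r where
  toFun c := (⟨c.override r 0, Conf.restrict_override r c 0⟩, c.restrict r)
  invFun p := p.1.1.override r p.2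
  left_inv c := by
    change (c.override r 0).override r (c.restrict r) = c
    rw [Conf.override_override, Conf.override_restrict]
  right_inv p := by
    obtain ⟨⟨c, hc⟩, x⟩ := p
    refine Prod.ext (Subtype.ext ?_) ?_
    · change (c.override r x).override r 0 = c
      rw [Conf.override_override, ← hc, Conf.override_restrict]
    · exact Conf.restrict_override r c x

/-- The slice of `ψ` at `c`: the vector `x ↦ ψ (c with x on the register)`. -/
def slice (ψ : Hall ty) (c : Conf ty) : RegSpace ty r :=
  ⟨fun x => ψ (c.override r x), L2.memℓp_of_summable
    ((L2.hasSum_norm_sq ψ).summable.comp_injective (Conf.override_injective r c))⟩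

lemma slice_apply (ψ : Hall ty) (c : Conf ty) (x : RegVal ty r) :
    slice r ψ c x = ψ (c.override r x) := rfl

lemma slice_override (ψ : Hall ty) (c : Conf ty) (x : RegVal ty r) :
    slice r ψ (c.override r x) = slice r ψ c := by
  apply lp.ext
  funext y
  change ψ ((c.override r x).override r y) = ψ (c.override r y)
  rw [Conf.override_override]

lemma hasSum_norm_slice (ψ : Hall ty) :
    HasSum (fun c : {c : Conf ty // c.restrict r = 0} => ‖slice r ψ c.1‖ ^ 2) (‖ψ‖ ^ 2) := by
  have h := ((Conf.split r).symm.hasSum_iff.2 (L2.hasSum_norm_sq ψ))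
  exact h.prod_fiberwise fun c => L2.hasSum_norm_sq (slice r ψ c.1)

/-- The values of `(A ⊗ I) ψ`. -/
def cylFun (A : RegOp ty r) (ψ : Hall ty) (c : Conf ty) : ℂ :=
  A (slice r ψ c) (c.restrict r)

lemma cylFun_hasSum (A : RegOp ty r) (ψ : Hall ty) :
    ∃ s, s ≤ (‖A‖ * ‖ψ‖) ^ 2 ∧ HasSum (fun c => ‖cylFun r A ψ c‖ ^ 2) s := by
  have hbd : ∀ c : {c : Conf ty // c.restrict r = 0},
      ‖A (slice r ψ c.1)‖ ^ 2 ≤ ‖A‖ ^ 2 * ‖slice r ψ c.1‖ ^ 2 := fun c => by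
    rw [← mul_pow]
    exact pow_le_pow_left₀ (norm_nonneg _) (A.le_opNorm _) 2
  have hs := (hasSum_norm_slice r ψ).mul_left (‖A‖ ^ 2)
  have hs' : Summable fun c : {c : Conf ty // c.restrict r = 0} => ‖A (slice r ψ c.1)‖ ^ 2 :=
    Summable.of_nonneg_of_le (fun _ => by positivity) hbd hs.summable
  have hval : ∀ p : {c : Conf ty // c.restrict r = 0} × RegVal ty r,
      cylFun r A ψ ((Conf.split r).symm p) = A (slice r ψ p.1.1) p.2 := fun p => by
    change A (slice r ψ (p.1.1.override r p.2)) ((p.1.1.override r p.2).restrict r) = _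
    rw [slice_override, Conf.restrict_override]
  have hsum : Summable fun p : {c : Conf ty // c.restrict r = 0} × RegVal ty r =>
      ‖A (slice r ψ p.1.1) p.2‖ ^ 2 := by
    rw [summable_prod_of_nonneg (fun _ => by positivity)]
    refine ⟨fun c => (L2.hasSum_norm_sq (A (slice r ψ c.1))).summable, ?_⟩
    simpa only [(L2.hasSum_norm_sq (A (slice r ψ _))).tsum_eq] using hs'
  have hfib := hsum.hasSum.prod_fiberwise fun c => L2.hasSum_norm_sq (A (slice r ψ c.1))
  refine ⟨_, ?_, ((Conf.split r).symm.hasSum_iff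
    (f := fun c => ‖cylFun r A ψ c‖ ^ 2)).1 (by
      have : ((fun c => ‖cylFun r A ψ c‖ ^ 2) ∘ (Conf.split r).symm) =
          fun p => ‖A (slice r ψ p.1.1) p.2‖ ^ 2 := funext fun p => by
        simp only [Function.comp_apply, hval]
      rw [this]
      exact hsum.hasSum)⟩
  rw [mul_pow]
  exact hasSum_le hbd hfib hs

/-- The cylinder extension `A ⊗ I` of an operator `A` on the register: on each slice, with the
values of all other variables fixed, it acts as `A`. -/
def cyl (A : RegOp ty r) : Op ty :=
  LinearMap.mkContinuous
    { toFun := fun ψ => ⟨cylFun r A ψ, L2.memℓp_of_summable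
        (cylFun_hasSum r A ψ).choose_spec.2.summable⟩
      map_add' := fun ψ φ => by
        apply lp.ext
        funext c
        change A (slice r (ψ + φ) c) _ = A (slice r ψ c) _ + A (slice r φ c) _
        have : slice r (ψ + φ) c = slice r ψ c + slice r φ c := rfl
        rw [this, map_add]
        rfl
      map_smul' := fun a ψ => by
        apply lp.ext
        funext c
        change A (slice r (a • ψ) c) _ = a * A (slice r ψ c) _
        have : slice r (a • ψ) c = a • slice r ψ c := rfl
        rw [this, map_smul]
        rfl }
    ‖A‖ (fun ψ => by
      obtain ⟨s, hs, hsum⟩ := cylFun_hasSum r A ψ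
      refine le_of_sq_le_sq ?_ (by positivity)
      refine le_trans (le_of_eq ?_) hs
      exact (L2.hasSum_norm_sq _).unique hsum)

lemma cyl_apply (A : RegOp ty r) (ψ : Hall ty) (c : Conf ty) :
    cyl r A ψ c = A (slice r ψ c) (c.restrict r) := rfl

end Cylinder

/-- The register that consists of the single variable `q`. -/
def single (q : Var) : Fin 1 ↪ Var := ⟨fun _ => q, fun i j _ => Subsingleton.elim i j⟩

/-- The basis label of the register `q` given by the value `a`. -/
def singleVal (q : Var) (a : Val (ty q)) : RegVal ty (single q) := fun _ => a

/-- The operator `|a⟩_q⟨b|` on the global state space. -/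
def ketbra (q : Var) (a b : Val (ty q)) : Op ty :=
  cyl (single q) (InnerProductSpace.rankOne ℂ (ket (singleVal q a)) (ket (singleVal q b)))

/-! ## Traces, partial density operators, quantum predicates -/

/-- The trace, computed in the computational basis. -/
def trace (A : Op ty) : ℂ := ∑' c : Conf ty, inner ℂ (ket c) (A (ket c))

/-- Partial density operators: positive trace operators of trace at most `1`. -/
def IsPartialDensity (ρ : Op ty) : Prop :=
  0 ≤ ρ ∧ Summable (fun c : Conf ty => inner ℂ (ket c) (ρ (ket c))) ∧ (trace ρ).re ≤ 1

/-- Quantum predicates: operators between `0` and `I` in the Löwner order. -/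
def IsPredicate (P : Op ty) : Prop := 0 ≤ P ∧ P ≤ 1

/-! ## Quantum programs -/

/-- A family of operators is a measurement if `∑ Mₘ† Mₘ = I`, the sum being taken in the
strong operator topology. -/
def IsMeasurement {n : ℕ} {r : Fin n ↪ Var} {ι : Type} (M : ι → RegOp ty r) : Prop :=
  ∀ ψ, HasSum (fun m => ((M m)† ∘L M m) ψ) ψ

variable (ty) in
/-- Quantum while-programs. -/
inductive Prog : Type (max u 1)
  | skip : Prog
  | init (q : Var) : Prog
  | unitary {n : ℕ} (r : Fin n ↪ Var) (U : RegOp ty r) (hU : U† ∘L U = 1) : Prog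
  | seq (S₁ S₂ : Prog) : Prog
  | measure {n : ℕ} (r : Fin n ↪ Var) {ι : Type} (M : ι → RegOp ty r) (hM : IsMeasurement M)
      (S : ι → Prog) : Prog
  | loop {n : ℕ} (r : Fin n ↪ Var) (M : Fin 2 → RegOp ty r) (hM : IsMeasurement M)
      (S : Prog) : Prog

/-- `S; T`, where the first part may be the empty program `E = none`, with `E; T = T`. -/
def andThen : Option (Prog ty) → Prog ty → Prog ty
  | none, T => T
  | some S, T => .seq S T

/-! ## Operational and denotational semantics -/

/-- The state `∑ₙ |0⟩_q⟨n| ρ |n⟩_q⟨0|`; `n` ranges over `{0, 1}` or `ℤ` according to the type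
of `q`. -/
def initState (q : Var) (ρ : Op ty) : Op ty :=
  ∑' n : Val (ty q), ketbra q 0 n ∘L ρ ∘L ketbra q n 0

/-- The transitions `⟨S, ρ⟩ → ⟨S', ρ'⟩`; the empty program `E` is `none`. The transitions are
data, so that different outcomes of a measurement give different transitions even if the target
configurations coincide. -/
inductive Step : Prog ty → Op ty → Option (Prog ty) → Op ty → Type (max u 1)
  | skip (ρ : Op ty) : Step .skip ρ none ρ
  | init (q : Var) (ρ : Op ty) : Step (.init q) ρ none (initState q ρ)
  | unitary {n : ℕ} (r : Fin n ↪ Var) (U : RegOp ty r) (hU : U† ∘L U = 1) (ρ : Op ty) :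
      Step (.unitary r U hU) ρ none (cyl r U ∘L ρ ∘L (cyl r U)†)
  | seq {S₁ : Prog ty} {ρ : Op ty} {S₁' : Option (Prog ty)} {ρ' : Op ty}
      (t : Step S₁ ρ S₁' ρ') (S₂ : Prog ty) : Step (.seq S₁ S₂) ρ (some (andThen S₁' S₂)) ρ'
  | measure {n : ℕ} (r : Fin n ↪ Var) {ι : Type} (M : ι → RegOp ty r) (hM : IsMeasurement M)
      (S : ι → Prog ty) (m : ι) (ρ : Op ty) :
      Step (.measure r M hM S) ρ (some (S m)) (cyl r (M m) ∘L ρ ∘L (cyl r (M m))†)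
  | loop0 {n : ℕ} (r : Fin n ↪ Var) (M : Fin 2 → RegOp ty r) (hM : IsMeasurement M)
      (S : Prog ty) (ρ : Op ty) :
      Step (.loop r M hM S) ρ none (cyl r (M 0) ∘L ρ ∘L (cyl r (M 0))†)
  | loop1 {n : ℕ} (r : Fin n ↪ Var) (M : Fin 2 → RegOp ty r) (hM : IsMeasurement M)
      (S : Prog ty) (ρ : Op ty) :
      Step (.loop r M hM S) ρ (some (.seq S (.loop r M hM S)))
        (cyl r (M 1) ∘L ρ ∘L (cyl r (M 1))†)

/-- The terminating computations `⟨S, ρ⟩ → ⋯ → ⟨E, ρ'⟩`. -/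
inductive Computation : Option (Prog ty) → Op ty → Op ty → Type (max u 1)
  | done (ρ : Op ty) : Computation none ρ ρ
  | step {S : Prog ty} {ρ : Op ty} {C : Option (Prog ty)} {ρ' ρ'' : Op ty}
      (t : Step S ρ C ρ') (k : Computation C ρ' ρ'') : Computation (some S) ρ ρ''

/-- The semantic function `⟦S⟧`: the sum, over all terminating computations of `S` from `ρ`, of
the states in which they terminate. -/
def sem (S : Prog ty) (ρ : Op ty) : Op ty :=
  ∑' k : (Σ ρ' : Op ty, Computation (some S) ρ ρ'), k.1

/-! ## Partial correctness and weakest liberal preconditions -/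

/-- `{P} S {Q}` is true in the sense of partial correctness. -/
def PartialCorrect (P : Op ty) (S : Prog ty) (Q : Op ty) : Prop :=
  ∀ ρ : Op ty, IsPartialDensity ρ →
    (trace (P ∘L ρ)).re ≤
      (trace (Q ∘L sem S ρ)).re + ((trace ρ).re - (trace (sem S ρ)).re)

/-- `W` is a weakest liberal precondition of `S` with respect to `P`. -/
def IsWlp (S : Prog ty) (P W : Op ty) : Prop :=
  IsPredicate W ∧ PartialCorrect W S P ∧ ∀ Q, IsPredicate Q → PartialCorrect Q S P → Q ≤ W

/-- The weakest liberal precondition `wlp.S.P` (unique if it exists, by antisymmetry of the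
Löwner order). -/
def wlp (S : Prog ty) (P : Op ty) : Op ty := Classical.epsilon (IsWlp S P)

/-- The sequence `P₀ = I`, `Pₙ₊₁ = M₀† P M₀ + M₁† (wlp.S.Pₙ) M₁`. -/
def loopSeq {n : ℕ} (r : Fin n ↪ Var) (M : Fin 2 → RegOp ty r) (S : Prog ty) (P : Op ty) :
    ℕ → Op ty
  | 0 => 1
  | k + 1 => (cyl r (M 0))† ∘L P ∘L cyl r (M 0) +
      (cyl r (M 1))† ∘L wlp S (loopSeq r M S P k) ∘L cyl r (M 1)

end QuantumProg

end

noncomputable section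

namespace QuantumProg

open scoped ENNReal Topology
open Filter

/-! ## Quadratic forms of bounded operators -/

section Hilbert

set_option linter.unusedSectionVars false

variable {H : Type*} [NormedAddCommGroup H] [InnerProductSpace ℂ H] [CompleteSpace H]

/-! Everything rests on one identity in `[0, ∞]`, `TraceIdentity`: `tr(Wρ) + ∑ tr(ρ') = ∑ tr(Pρ') +
tr(ρ)`, the sums running over the final states `ρ'` of the terminating computations from `ρ`. It has
no subtraction and only nonnegative terms, so it can be rearranged freely.

A predicate `W` satisfying it is the weakest liberal precondition. If `Q` is partially correct,
comparison with the identity and cancellation of the finite quantity `∑ tr(ρ')` give `tr(Qρ) ≤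
tr(Wρ)` for all partial density operators; testing on pure states yields `Q ≤ W`
(`le_of_forall_etr_le`, `TraceIdentity.isWlp`). The finiteness comes from the identity itself: for
`P = 0` it says that total trace does not increase. The same bound makes the sum defining `sem`
converge in norm. It remains to find, by structural induction (`wlpSpec`), a `W` for each construct;
this `W` is the operator of the claimed formula, so the formulas follow by uniqueness.

The pairing `tr(Pρ)` is handled as `∑ ⟨√P c, ρ √P c⟩ = ∑ ⟨√ρ c, P √ρ c⟩`, an equality of two
Hilbert–Schmidt norms. One form is countably additive in `ρ`, the other is monotone and additive in
`P`; `hasSum_inner_comp` connects them with the basis trace of `P ∘L ρ`.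

Composition is handled by induction on the number of steps (`outcomeSum_seq`). For a loop, `Pₖ`
satisfies the identity restricted to computations with fewer than `k` iterations
(`etr_loopSeq_add`). As `k → ∞` the sums converge monotonically, and the decreasing `Pₖ` converge
strongly, hence in trace against `ρ` by dominated convergence (`exists_loop`). -/

lemma enorm_sq_eq_ofReal {E : Type*} [SeminormedAddCommGroup E] (x : E) :
    ‖x‖ₑ ^ 2 = ENNReal.ofReal (‖x‖ ^ 2) := by
  rw [ENNReal.ofReal_pow (norm_nonneg _), ofReal_norm]

/-- A square root of a positive operator. -/
def psqrt (A : H →L[ℂ] H) : H →L[ℂ] H := CFC.sqrt A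

lemma psqrt_adjoint (A : H →L[ℂ] H) : (psqrt A)† = psqrt A := by
  have h : (0 : H →L[ℂ] H) ≤ psqrt A := CFC.sqrt_nonneg A
  exact (IsSelfAdjoint.of_nonneg h).star_eq

lemma psqrt_comp_self {A : H →L[ℂ] H} (hA : 0 ≤ A) : psqrt A ∘L psqrt A = A :=
  CFC.sqrt_mul_sqrt_self A hA

lemma psqrt_one : psqrt (1 : H →L[ℂ] H) = 1 := CFC.sqrt_one

/-- The quadratic form `⟨x, A x⟩`, as an extended nonnegative real. -/
def qf (A : H →L[ℂ] H) (x : H) : ℝ≥0∞ := ENNReal.ofReal (inner ℂ x (A x)).re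

lemma qf_comp_adjoint (B : H →L[ℂ] H) (x : H) : qf (B ∘L B†) x = ‖(B†) x‖ₑ ^ 2 := by
  rw [enorm_sq_eq_ofReal, qf, ContinuousLinearMap.comp_apply,
    ← ContinuousLinearMap.adjoint_inner_left, inner_self_eq_norm_sq_to_K]
  norm_cast

lemma qf_conj (A P : H →L[ℂ] H) (x : H) : qf (A† ∘L P ∘L A) x = qf P (A x) := by
  simp only [qf, ContinuousLinearMap.comp_apply, ContinuousLinearMap.adjoint_inner_right]

lemma qf_one (x : H) : qf 1 x = ‖x‖ₑ ^ 2 := by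
  rw [enorm_sq_eq_ofReal, qf, one_apply_eq_self, inner_self_eq_norm_sq_to_K]
  norm_cast

lemma qf_zero (x : H) : qf 0 x = 0 := by simp [qf]

lemma nonneg_iff_re_inner {A : H →L[ℂ] H} :
    0 ≤ A ↔ IsSelfAdjoint A ∧ ∀ x, 0 ≤ (inner ℂ x (A x)).re := by
  rw [ContinuousLinearMap.nonneg_iff_isPositive, ContinuousLinearMap.isPositive_def']
  refine and_congr_right fun _ => forall_congr' fun x => ?_
  rw [ContinuousLinearMap.reApplyInnerSelf_apply, inner_re_symm]
  rfl

lemma re_inner_nonneg {A : H →L[ℂ] H} (hA : 0 ≤ A) (x : H) : 0 ≤ (inner ℂ x (A x)).re :=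
  (nonneg_iff_re_inner.1 hA).2 x

lemma ofReal_re_inner {A : H →L[ℂ] H} (hA : 0 ≤ A) (x : H) :
    (((inner ℂ x (A x)).re : ℝ) : ℂ) = inner ℂ x (A x) := by
  have h := ((ContinuousLinearMap.nonneg_iff_isPositive A).1 hA).inner_nonneg_right x
  exact (Complex.eq_re_of_ofReal_le (r := 0) (by simpa using h)).symm

lemma le_iff_re_inner {A B : H →L[ℂ] H} (hA : IsSelfAdjoint A) (hB : IsSelfAdjoint B) :
    A ≤ B ↔ ∀ x, (inner ℂ x (A x)).re ≤ (inner ℂ x (B x)).re := by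
  rw [← sub_nonneg, nonneg_iff_re_inner]
  simp [hB.sub hA]

lemma le_iff_qf {A B : H →L[ℂ] H} (hA : 0 ≤ A) (hB : 0 ≤ B) :
    A ≤ B ↔ ∀ x, qf A x ≤ qf B x := by
  rw [le_iff_re_inner (.of_nonneg hA) (.of_nonneg hB)]
  exact forall_congr' fun x => (ENNReal.ofReal_le_ofReal_iff (re_inner_nonneg hB x)).symm

lemma conj_nonneg {ρ : H →L[ℂ] H} (hρ : 0 ≤ ρ) (A : H →L[ℂ] H) : 0 ≤ A ∘L ρ ∘L A† :=
  (ContinuousLinearMap.nonneg_iff_isPositive _).2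
    (((ContinuousLinearMap.nonneg_iff_isPositive _).1 hρ).conj_adjoint A)

lemma adjoint_conj_nonneg {ρ : H →L[ℂ] H} (hρ : 0 ≤ ρ) (A : H →L[ℂ] H) : 0 ≤ A† ∘L ρ ∘L A :=
  (ContinuousLinearMap.nonneg_iff_isPositive _).2
    (((ContinuousLinearMap.nonneg_iff_isPositive _).1 hρ).adjoint_conj A)

open scoped ComplexOrder in
lemma nonneg_of_tendsto {α : Type*} {l : Filter α} [l.NeBot] {A : α → H →L[ℂ] H}
    {W : H →L[ℂ] H} (hA : ∀ᶠ i in l, 0 ≤ A i) (h : ∀ x, Tendsto (fun i => A i x) l (𝓝 (W x))) :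
    0 ≤ W := by
  rw [ContinuousLinearMap.nonneg_iff_isPositive, ContinuousLinearMap.isPositive_iff]
  have key : ∀ x, Tendsto (fun i => inner ℂ (A i x) x) l (𝓝 (inner ℂ (W x) x)) := fun x =>
    (h x).inner tendsto_const_nhds
  refine ⟨fun x y => ?_, fun x => ?_⟩
  · refine tendsto_nhds_unique ((h x).inner tendsto_const_nhds)
      ((tendsto_const_nhds.inner (h y)).congr' ?_)
    filter_upwards [hA] with i hi
    exact (((ContinuousLinearMap.nonneg_iff_isPositive _).1 hi).inner_left_eq_inner_right x y).symm
  · refine ge_of_tendsto (key x) ?_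
    filter_upwards [hA] with i hi
    exact ((ContinuousLinearMap.nonneg_iff_isPositive _).1 hi).inner_nonneg_left x

lemma le_of_tendsto_apply {α : Type*} {l : Filter α} [l.NeBot] {A : α → H →L[ℂ] H}
    {W B : H →L[ℂ] H} (hA : ∀ᶠ i in l, A i ≤ B)
    (h : ∀ x, Tendsto (fun i => A i x) l (𝓝 (W x))) : W ≤ B := by
  rw [← sub_nonneg]
  refine nonneg_of_tendsto (l := l) (A := fun i => B - A i) ?_ fun x =>
    tendsto_const_nhds.sub (h x)
  filter_upwards [hA] with i hi using sub_nonneg.2 hi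

lemma ge_of_tendsto_apply {α : Type*} {l : Filter α} [l.NeBot] {A : α → H →L[ℂ] H}
    {W B : H →L[ℂ] H} (hA : ∀ᶠ i in l, B ≤ A i)
    (h : ∀ x, Tendsto (fun i => A i x) l (𝓝 (W x))) : B ≤ W := by
  rw [← sub_nonneg]
  refine nonneg_of_tendsto (l := l) (A := fun i => A i - B) ?_ fun x =>
    (h x).sub tendsto_const_nhds
  filter_upwards [hA] with i hi using sub_nonneg.2 hi

lemma norm_le_one_of_nonneg_of_le_one {A : H →L[ℂ] H} (h0 : 0 ≤ A) (h1 : A ≤ 1) : ‖A‖ ≤ 1 := by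
  by_cases hH : Nontrivial H
  · exact CStarAlgebra.norm_le_one_iff_of_nonneg A h0 |>.2 h1
  · rw [not_nontrivial_iff_subsingleton] at hH
    exact (le_of_eq (by rw [Subsingleton.elim A 0, norm_zero])).trans zero_le_one

/-- Write `A` as the square of `√A`, which is a contraction. Applied to differences in a monotone
net, the bound turns convergence of quadratic forms into norm convergence of the vectors `A i x`. -/
lemma norm_sq_apply_le {A : H →L[ℂ] H} (h0 : 0 ≤ A) (h1 : A ≤ 1) (x : H) :
    ‖A x‖ ^ 2 ≤ (inner ℂ x (A x)).re := by
  have hs : ‖psqrt A‖ ≤ 1 := by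
    have : ‖psqrt A‖ ^ 2 = ‖A‖ := by
      conv_rhs => rw [← psqrt_comp_self h0]
      nth_rw 2 [← psqrt_adjoint A]
      rw [ContinuousLinearMap.norm_adjoint_comp_self, sq]
    nlinarith [norm_le_one_of_nonneg_of_le_one h0 h1, norm_nonneg (psqrt A)]
  have e : (inner ℂ x (A x)).re = ‖psqrt A x‖ ^ 2 := by
    conv_lhs => rw [← psqrt_comp_self h0]
    nth_rw 1 [← psqrt_adjoint A]
    rw [ContinuousLinearMap.comp_apply, ContinuousLinearMap.adjoint_inner_right,
      inner_self_eq_norm_sq_to_K]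
    norm_cast
  rw [e]
  refine pow_le_pow_left₀ (norm_nonneg _) ?_ 2
  conv_lhs => rw [← psqrt_comp_self h0]
  exact ((psqrt A).le_opNorm _).trans (mul_le_of_le_one_left (norm_nonneg _) hs)

/-- A decreasing net of operators between `0` and `1` converges strongly. -/
lemma exists_tendsto_of_antitone {α : Type*} [SemilatticeSup α] [Nonempty α]
    {A : α → H →L[ℂ] H} (hA : Antitone A) (h0 : ∀ i, 0 ≤ A i) (h1 : ∀ i, A i ≤ 1) :
    ∃ W : H →L[ℂ] H, 0 ≤ W ∧ W ≤ 1 ∧ ∀ x, Tendsto (fun i => A i x) atTop (𝓝 (W x)) := by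
  have hmono : ∀ x, Antitone fun i => (inner ℂ x (A i x)).re := fun x i j hij =>
    (le_iff_re_inner (.of_nonneg (h0 j)) (.of_nonneg (h0 i))).1 (hA hij) x
  have hbd : ∀ x, BddBelow (Set.range fun i => (inner ℂ x (A i x)).re) := fun x =>
    ⟨0, by rintro _ ⟨i, rfl⟩; exact re_inner_nonneg (h0 i) x⟩
  have hdiff : ∀ x i j, i ≤ j →
      ‖A i x - A j x‖ ^ 2 ≤ (inner ℂ x (A i x)).re - (inner ℂ x (A j x)).re := fun x i j hij => by
    have := norm_sq_apply_le (sub_nonneg.2 (hA hij))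
      ((sub_le_self _ (h0 j)).trans (h1 i)) x
    simpa [inner_sub_right] using this
  have hlim : ∀ x, ∃ y, Tendsto (fun i => A i x) atTop (𝓝 y) := fun x => by
    refine cauchySeq_tendsto_of_complete (Metric.cauchySeq_iff'.2 fun ε hε => ?_)
    -- Beyond `N` the quadratic form, already within `ε ^ 2` of its infimum, can drop by less than
    -- `ε ^ 2`.
    obtain ⟨N, hN⟩ := ((tendsto_order.1 (tendsto_atTop_ciInf (hmono x) (hbd x))).2
      ((⨅ i, (inner ℂ x (A i x)).re) + ε ^ 2) (lt_add_of_pos_right _ (by positivity))).exists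
    refine ⟨N, fun i hi => ?_⟩
    have h3 := hdiff x N i hi
    have h4 := ciInf_le (hbd x) i
    rw [dist_comm, dist_eq_norm]
    exact lt_of_pow_lt_pow_left₀ 2 hε.le (by linarith)
  choose f hf using hlim
  let W : H →L[ℂ] H := LinearMap.mkContinuous
    { toFun := f
      map_add' := fun x y => tendsto_nhds_unique (hf (x + y))
        (by simpa only [map_add] using (hf x).add (hf y))
      map_smul' := fun a x => tendsto_nhds_unique (hf (a • x))
        (by simpa only [map_smul, RingHom.id_apply] using (hf x).const_smul a) }
    1 fun x => le_of_tendsto (hf x).norm (Eventually.of_forall fun i =>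
      ((A i).le_of_opNorm_le (norm_le_one_of_nonneg_of_le_one (h0 i) (h1 i)) x))
  exact ⟨W, nonneg_of_tendsto (.of_forall h0) hf, le_of_tendsto_apply (.of_forall h1) hf, hf⟩

/-- The strong sum of the operators `Kᵢ† Wᵢ Kᵢ` exists if `∑ ‖Kᵢ x‖² = ‖x‖²`. -/
lemma exists_hasSum_conj {ι : Type*} {K W : ι → H →L[ℂ] H}
    (hK : ∀ x, ∑' i, ‖K i x‖ₑ ^ 2 = ‖x‖ₑ ^ 2) (hW : ∀ i, 0 ≤ W i ∧ W i ≤ 1) :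
    ∃ V : H →L[ℂ] H, 0 ≤ V ∧ V ≤ 1 ∧
      ∀ x, HasSum (fun i => ((K i)† ∘L W i ∘L K i) x) (V x) := by
  classical
  have hnn : ∀ i, 0 ≤ (K i)† ∘L W i ∘L K i := fun i => adjoint_conj_nonneg (hW i).1 _
  have hle : ∀ s : Finset ι, ∑ i ∈ s, (K i)† ∘L W i ∘L K i ≤ 1 := fun s => by
    refine (le_iff_qf (Finset.sum_nonneg fun i _ => hnn i) zero_le_one).2 fun x => ?_
    calc qf (∑ i ∈ s, (K i)† ∘L W i ∘L K i) x
        = ∑ i ∈ s, qf ((K i)† ∘L W i ∘L K i) x := by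
          simp only [qf, sum_apply, inner_sum, Complex.re_sum]
          exact ENNReal.ofReal_sum_of_nonneg fun i _ => re_inner_nonneg (hnn i) x
      _ ≤ ∑ i ∈ s, ‖K i x‖ₑ ^ 2 := Finset.sum_le_sum fun i _ => by
          rw [qf_conj, ← qf_one]
          exact (le_iff_qf (hW i).1 zero_le_one).1 (hW i).2 _
      _ ≤ qf 1 x := by
          rw [qf_one, ← hK]
          exact ENNReal.sum_le_tsum s
  -- The partial sums increase, so their complements in `1` form a decreasing net.
  obtain ⟨V, h0, h1, hV⟩ := exists_tendsto_of_antitone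
    (A := fun s : Finset ι => 1 - ∑ i ∈ s, (K i)† ∘L W i ∘L K i)
    (fun s t hst => sub_le_sub_left
      (Finset.sum_le_sum_of_subset_of_nonneg hst fun i _ _ => hnn i) _)
    (fun s => sub_nonneg.2 (hle s)) (fun s => sub_le_self _ (Finset.sum_nonneg fun i _ => hnn i))
  refine ⟨1 - V, sub_nonneg.2 h1, sub_le_self _ h0, fun x => ?_⟩
  have := (tendsto_const_nhds (x := x)).sub (hV x)
  simpa [HasSum] using this

lemma qf_eq_tsum_of_hasSum {ι : Type*} {A : ι → H →L[ℂ] H} {V : H →L[ℂ] H} (hA : ∀ i, 0 ≤ A i)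
    {x : H} (h : HasSum (fun i => A i x) (V x)) : qf V x = ∑' i, qf (A i) x := by
  have h1 : HasSum (fun i => (inner ℂ x (A i x)).re) (inner ℂ x (V x)).re :=
    (h.mapL (innerSL ℂ x)).mapL Complex.reCLM
  rw [qf, ← h1.tsum_eq, ENNReal.ofReal_tsum_of_nonneg (fun i => re_inner_nonneg (hA i) x)
    h1.summable]
  rfl

end Hilbert

/-! ## The trace pairing of positive operators -/

section TracePairing

variable {X : Type*}

lemma L2.tsum_enorm_sq (ψ : L2 X) : ∑' x, ‖ψ x‖ₑ ^ 2 = ‖ψ‖ₑ ^ 2 := by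
  have h := L2.hasSum_norm_sq ψ
  simp_rw [enorm_sq_eq_ofReal]
  rw [← h.tsum_eq, ENNReal.ofReal_tsum_of_nonneg (fun _ => by positivity) h.summable]

/-- The square of the Hilbert–Schmidt norm. -/
def hsNormSq (T : L2 X →L[ℂ] L2 X) : ℝ≥0∞ := ∑' c, ‖T (ket c)‖ₑ ^ 2

/-- Both sides are the double sum of squared absolute matrix entries, summed in opposite orders.
This is the source of every cyclicity property of the trace used here. -/
lemma hsNormSq_adjoint (T : L2 X →L[ℂ] L2 X) : hsNormSq (T†) = hsNormSq T := by
  have h : ∀ c d, ‖((T†) (ket c)) d‖ₑ = ‖(T (ket d)) c‖ₑ := fun c d => by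
    rw [← inner_ket, ← inner_ket, ContinuousLinearMap.adjoint_inner_right,
      ← inner_conj_symm, RCLike.enorm_conj]
  simp_rw [hsNormSq, ← L2.tsum_enorm_sq, h]
  exact ENNReal.tsum_comm

/-- Coordinate `c` of `T ψ` is the inner product of `T† (ket c)` with `ψ`; apply Cauchy–Schwarz in
each coordinate. -/
lemma enorm_apply_sq_le_hsNormSq (T : L2 X →L[ℂ] L2 X) (ψ : L2 X) :
    ‖T ψ‖ₑ ^ 2 ≤ hsNormSq T * ‖ψ‖ₑ ^ 2 := by
  rw [← hsNormSq_adjoint, hsNormSq, ← ENNReal.tsum_mul_right, ← L2.tsum_enorm_sq]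
  refine ENNReal.tsum_le_tsum fun c => ?_
  rw [← inner_ket, ← ContinuousLinearMap.adjoint_inner_left, ← mul_pow]
  refine pow_le_pow_left' ?_ 2
  simp only [← ofReal_norm]
  rw [← ENNReal.ofReal_mul (norm_nonneg _)]
  exact ENNReal.ofReal_le_ofReal (norm_inner_le_norm _ _)

/-- The extended trace `tr(Pρ)` of positive operators. -/
def etr (P ρ : L2 X →L[ℂ] L2 X) : ℝ≥0∞ := ∑' c, qf ρ (psqrt P (ket c))

lemma etr_one (ρ : L2 X →L[ℂ] L2 X) : etr 1 ρ = ∑' c, qf ρ (ket c) := by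
  simp [etr, psqrt_one]

/-- The two sides are the squared Hilbert–Schmidt norms of `B† √P` and of its adjoint `√P B`. This
moves the square root from the predicate to the state. -/
lemma etr_self_comp_adjoint {P : L2 X →L[ℂ] L2 X} (hP : 0 ≤ P) (B : L2 X →L[ℂ] L2 X) :
    etr P (B ∘L B†) = ∑' c, qf P (B (ket c)) := by
  calc etr P (B ∘L B†) = hsNormSq ((psqrt P ∘L B)†) := by
        rw [ContinuousLinearMap.adjoint_comp, psqrt_adjoint]
        exact tsum_congr fun c => qf_comp_adjoint B _
    _ = ∑' c, qf P (B (ket c)) := by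
        rw [hsNormSq_adjoint]
        refine tsum_congr fun c => ?_
        conv_rhs => rw [← psqrt_comp_self hP]
        nth_rw 3 [← psqrt_adjoint P]
        rw [qf_comp_adjoint, psqrt_adjoint]
        rfl

lemma etr_eq_tsum_qf {P ρ : L2 X →L[ℂ] L2 X} (hP : 0 ≤ P) (hρ : 0 ≤ ρ) :
    etr P ρ = ∑' c, qf P (psqrt ρ (ket c)) := by
  rw [← etr_self_comp_adjoint hP, psqrt_adjoint, psqrt_comp_self hρ]

lemma etr_mono {P Q ρ : L2 X →L[ℂ] L2 X} (hP : 0 ≤ P) (hPQ : P ≤ Q) (hρ : 0 ≤ ρ) :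
    etr P ρ ≤ etr Q ρ := by
  rw [etr_eq_tsum_qf hP hρ, etr_eq_tsum_qf (hP.trans hPQ) hρ]
  exact ENNReal.tsum_le_tsum fun c => (le_iff_qf hP (hP.trans hPQ)).1 hPQ _

lemma etr_zero_left {ρ : L2 X →L[ℂ] L2 X} (hρ : 0 ≤ ρ) : etr 0 ρ = 0 := by
  simp [etr_eq_tsum_qf le_rfl hρ, qf_zero]

lemma etr_conj {P ρ : L2 X →L[ℂ] L2 X} (hP : 0 ≤ P) (hρ : 0 ≤ ρ) (A : L2 X →L[ℂ] L2 X) :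
    etr P (A ∘L ρ ∘L A†) = ∑' c, qf P (A (psqrt ρ (ket c))) := by
  have h : A ∘L ρ ∘L A† = (A ∘L psqrt ρ) ∘L (A ∘L psqrt ρ)† := by
    rw [ContinuousLinearMap.adjoint_comp, psqrt_adjoint]
    conv_lhs => rw [← psqrt_comp_self hρ]
    rfl
  rw [h, etr_self_comp_adjoint hP]
  rfl

/-- Stated through quadratic forms so that it covers both strong operator sums (initialization,
measurement) and, with `V` and all `W i` equal to `1`, conservation of trace. -/
lemma etr_eq_tsum_conj {ι : Type*} {K W : ι → L2 X →L[ℂ] L2 X} {V ρ : L2 X →L[ℂ] L2 X}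
    (hV : 0 ≤ V) (hW : ∀ i, 0 ≤ W i) (hρ : 0 ≤ ρ)
    (h : ∀ x, qf V x = ∑' i, qf (W i) (K i x)) :
    etr V ρ = ∑' i, etr (W i) (K i ∘L ρ ∘L (K i)†) := by
  simp_rw [etr_eq_tsum_qf hV hρ, etr_conj (hW _) hρ, h]
  exact ENNReal.tsum_comm

lemma etr_conj_eq {P ρ : L2 X →L[ℂ] L2 X} (hP : 0 ≤ P) (hρ : 0 ≤ ρ) (A : L2 X →L[ℂ] L2 X) :
    etr P (A ∘L ρ ∘L A†) = etr (A† ∘L P ∘L A) ρ := by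
  simp_rw [etr_conj hP hρ, etr_eq_tsum_qf (adjoint_conj_nonneg hP A) hρ, qf_conj]

lemma etr_hasSum_right {κ : Type*} {σ : κ → L2 X →L[ℂ] L2 X} {ρ : L2 X →L[ℂ] L2 X}
    (hσ : ∀ k, 0 ≤ σ k) (h : HasSum σ ρ) (P : L2 X →L[ℂ] L2 X) :
    etr P ρ = ∑' k, etr P (σ k) := by
  have : ∀ x, qf ρ x = ∑' k, qf (σ k) x := fun x =>
    qf_eq_tsum_of_hasSum hσ (h.mapL (ContinuousLinearMap.apply ℂ (L2 X) x))
  simp_rw [etr, this]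
  exact ENNReal.tsum_comm

/-- The trace of `ρ` is the squared Hilbert–Schmidt norm of `√ρ`, and `ρ ψ` arises from two
applications of `√ρ`. Hence families of positive operators with finite total trace are absolutely
summable in operator norm. -/
lemma enorm_le_etr_one {ρ : L2 X →L[ℂ] L2 X} (hρ : 0 ≤ ρ) : ‖ρ‖ₑ ≤ etr 1 ρ := by
  have h1 : etr 1 ρ = hsNormSq (psqrt ρ) := by
    rw [etr_eq_tsum_qf zero_le_one hρ]
    simp_rw [qf_one]
    rfl
  rw [h1]
  rcases eq_or_ne (hsNormSq (psqrt ρ)) ∞ with htop | htop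
  · simp [htop]
  have h2 : ∀ ψ, ‖ρ ψ‖ₑ ^ 2 ≤ (hsNormSq (psqrt ρ) * ‖ψ‖ₑ) ^ 2 := fun ψ => by
    have h3 := enorm_apply_sq_le_hsNormSq (psqrt ρ) ψ
    have h4 := enorm_apply_sq_le_hsNormSq (psqrt ρ) (psqrt ρ ψ)
    have h5 : ρ ψ = psqrt ρ (psqrt ρ ψ) := by
      conv_lhs => rw [← psqrt_comp_self hρ]
      rfl
    rw [h5]
    calc _ ≤ hsNormSq (psqrt ρ) * (hsNormSq (psqrt ρ) * ‖ψ‖ₑ ^ 2) := by grw [h4, h3]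
      _ = _ := by ring
  have h6 : ‖ρ‖ ≤ (hsNormSq (psqrt ρ)).toReal := by
    refine ρ.opNorm_le_bound ENNReal.toReal_nonneg fun ψ => ?_
    have h7 := (ENNReal.pow_right_strictMono two_ne_zero).le_iff_le.1 (h2 ψ)
    have h8 := ENNReal.toReal_mono (ENNReal.mul_ne_top htop enorm_ne_top) h7
    simpa using h8
  rw [← ofReal_norm]
  exact ENNReal.ofReal_le_of_le_toReal h6

lemma summable_of_tsum_etr_one {κ : Type*} {σ : κ → L2 X →L[ℂ] L2 X} (hσ : ∀ k, 0 ≤ σ k)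
    (h : ∑' k, etr 1 (σ k) ≠ ∞) : Summable σ := by
  have h1 : ∑' k, ‖σ k‖ₑ ≠ ∞ :=
    ne_top_of_le_ne_top h (ENNReal.tsum_le_tsum fun k => enorm_le_etr_one (hσ k))
  refine Summable.of_norm ?_
  simpa using ENNReal.summable_toReal h1

lemma summable_norm_sq_of_tsum_enorm_sq {κ E : Type*} [SeminormedAddCommGroup E] {f : κ → E}
    (h : ∑' k, ‖f k‖ₑ ^ 2 ≠ ∞) : Summable fun k => ‖f k‖ ^ 2 := by
  simpa using ENNReal.summable_toReal h

/-- The trace formula `∑ c, ⟨c, P ρ c⟩ = ∑ d, ⟨√ρ d, P √ρ d⟩`. -/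
lemma hasSum_inner_comp {P ρ : L2 X →L[ℂ] L2 X} (hP : 0 ≤ P) (hρ : 0 ≤ ρ)
    (hfin : etr 1 ρ ≠ ∞) :
    HasSum (fun c => inner ℂ (ket c) ((P ∘L ρ) (ket c))) ((etr P ρ).toReal : ℂ) := by
  set B := psqrt ρ with hB
  have h1 : ∑' c, ‖B (ket c)‖ₑ ^ 2 ≠ ∞ := by
    rw [etr_eq_tsum_qf zero_le_one hρ] at hfin
    simpa only [qf_one] using hfin
  have h2 : ∑' c, ‖P (B (ket c))‖ₑ ^ 2 ≠ ∞ := by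
    refine ne_top_of_le_ne_top (ENNReal.mul_ne_top (enorm_ne_top (x := P) |> ENNReal.pow_ne_top
      (n := 2)) h1) ?_
    rw [← ENNReal.tsum_mul_left]
    refine ENNReal.tsum_le_tsum fun c => ?_
    rw [← mul_pow]
    exact pow_le_pow_left' (ContinuousLinearMap.le_opENorm _ _) 2
  have key : ∀ f : X → L2 X, (∑' c, ‖f c‖ₑ ^ 2 ≠ ∞) →
      Summable fun p : X × X => ‖f p.1 p.2‖ ^ 2 := fun f hf => by
    refine summable_norm_sq_of_tsum_enorm_sq ?_
    rw [ENNReal.tsum_prod (f := fun c d => ‖f c d‖ₑ ^ 2)]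
    simpa only [L2.tsum_enorm_sq] using hf
  -- The family is absolutely summable because `ab ≤ a² + b²`. Its two iterated sums are then equal:
  -- `hrow` gives the terms of `etr P ρ`, and `hcol` gives the diagonal entries of `P ∘L ρ`.
  have hs : Summable fun p : X × X => inner ℂ (B (ket p.1) p.2) (P (B (ket p.1)) p.2) := by
    refine Summable.of_norm_bounded ((key _ h1).add (key _ h2)) fun p => ?_
    refine (norm_inner_le_norm _ _).trans ?_
    nlinarith [sq_nonneg (‖B (ket p.1) p.2‖ - ‖P (B (ket p.1)) p.2‖),
      sq_nonneg (‖B (ket p.1) p.2‖), sq_nonneg (‖P (B (ket p.1)) p.2‖)]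
  have hrow : ∀ d, HasSum (fun c => inner ℂ (B (ket d) c) (P (B (ket d)) c))
      (inner ℂ (B (ket d)) (P (B (ket d)))) := fun d => lp.hasSum_inner _ _
  have hcol : ∀ c, HasSum (fun d => inner ℂ (B (ket d) c) (P (B (ket d)) c))
      (inner ℂ (ket c) ((P ∘L ρ) (ket c))) := fun c => by
    have h3 := lp.hasSum_inner (𝕜 := ℂ) (B ((P†) (ket c))) (B (ket c))
    have h4 : inner ℂ (B ((P†) (ket c))) (B (ket c)) = inner ℂ (ket c) ((P ∘L ρ) (ket c)) := by
      rw [hB, ← psqrt_adjoint ρ, ContinuousLinearMap.adjoint_inner_left, psqrt_adjoint,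
        ContinuousLinearMap.adjoint_inner_left]
      conv_rhs => rw [← psqrt_comp_self hρ]
      rfl
    rw [h4] at h3
    refine h3.congr_fun ?_
    intro d
    have h5 : B ((P†) (ket c)) d = starRingEnd ℂ (P (B (ket d)) c) := by
      rw [← inner_ket, ← inner_ket, hB, ← ContinuousLinearMap.adjoint_inner_left, psqrt_adjoint,
        ContinuousLinearMap.adjoint_inner_right, inner_conj_symm]
    have h6 : B (ket c) d = starRingEnd ℂ (B (ket d) c) := by
      rw [← inner_ket, ← inner_ket, hB, ← ContinuousLinearMap.adjoint_inner_left, psqrt_adjoint,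
        inner_conj_symm]
    rw [h5, h6]
    simp [mul_comm]
  have h7 : HasSum (fun d => inner ℂ (B (ket d)) (P (B (ket d)))) ((etr P ρ).toReal : ℂ) := by
    have h8 := hs.hasSum.prod_fiberwise hrow
    have h9 : HasSum (fun d => (inner ℂ (B (ket d)) (P (B (ket d)))).re) (etr P ρ).toReal := by
      rw [etr_eq_tsum_qf hP hρ, ENNReal.tsum_toReal_eq fun c => by simp [qf]]
      simp only [qf, ENNReal.toReal_ofReal (re_inner_nonneg hP _)]
      exact (h8.mapL Complex.reCLM).summable.hasSum
    have h10 := Complex.hasSum_ofReal.2 h9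
    simpa only [ofReal_re_inner hP] using h10
  have h11 := ((Equiv.prodComm X X).hasSum_iff.2 hs.hasSum).prod_fiberwise hcol
  rwa [(hs.hasSum.prod_fiberwise hrow).unique h7] at h11

/-- Dominated convergence for the counting measure on basis labels; the dominating function is the
quadratic form of `1`, whose sum is the finite trace of `ρ`. -/
lemma tendsto_etr_left {A : ℕ → L2 X →L[ℂ] L2 X} {W ρ : L2 X →L[ℂ] L2 X}
    (hA : ∀ n, 0 ≤ A n ∧ A n ≤ 1) (hW : 0 ≤ W) (hρ : 0 ≤ ρ) (hfin : etr 1 ρ ≠ ∞)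
    (h : ∀ x, Tendsto (fun n => A n x) atTop (𝓝 (W x))) :
    Tendsto (fun n => etr (A n) ρ) atTop (𝓝 (etr W ρ)) := by
  simp_rw [etr_eq_tsum_qf (hA _).1 hρ, etr_eq_tsum_qf hW hρ]
  rw [etr_eq_tsum_qf zero_le_one hρ] at hfin
  let : MeasurableSpace X := ⊤
  simp_rw [← MeasureTheory.lintegral_count] at hfin ⊢
  refine MeasureTheory.tendsto_lintegral_of_dominated_convergence
    (fun c => qf 1 (psqrt ρ (ket c))) (fun n => measurable_from_top)
    (fun n => .of_forall fun c => ?_) hfin (.of_forall fun c => ?_)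
  · exact (le_iff_qf (hA n).1 zero_le_one).1 (hA n).2 _
  · exact ENNReal.tendsto_ofReal
      ((Complex.continuous_re.tendsto _).comp (tendsto_const_nhds.inner (h _)))

end TracePairing

/-! ## Sums over terminating computations -/

section Computations

variable {Var : Type*} {ty : Var → QType}

/-- The transitions from a configuration. -/
abbrev Steps (S : Prog ty) (ρ : Op ty) := Σ C : Option (Prog ty), Σ ρ' : Op ty, Step S ρ C ρ'

/-- The terminating computations from a configuration. -/
abbrev Outcomes (C : Option (Prog ty)) (ρ : Op ty) := Σ ρ' : Op ty, Computation C ρ ρ'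

/-- The empty program has exactly one computation. -/
def outcomesNone (ρ : Op ty) : Outcomes none ρ ≃ Unit where
  toFun _ := ()
  invFun _ := ⟨ρ, .done ρ⟩
  left_inv := by rintro ⟨_, k⟩; cases k; rfl
  right_inv _ := rfl

/-- A computation consists of a first transition and a computation from its target. -/
def outcomesSome (S : Prog ty) (ρ : Op ty) :
    Outcomes (some S) ρ ≃ Σ s : Steps S ρ, Outcomes s.1 s.2.1 where
  toFun := fun ⟨ρ'', k⟩ => match k with
    | .step t k => ⟨⟨_, _, t⟩, ⟨ρ'', k⟩⟩
  invFun := fun ⟨⟨_, _, t⟩, ⟨ρ'', k⟩⟩ => ⟨ρ'', .step t k⟩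
  left_inv := by rintro ⟨_, k⟩; cases k; rfl
  right_inv := by rintro ⟨⟨_, _, t⟩, ⟨ρ'', k⟩⟩; rfl

/-- `skip` has one transition. -/
def stepsSkip (ρ : Op ty) : Steps .skip ρ ≃ Unit where
  toFun _ := ()
  invFun _ := ⟨_, _, .skip ρ⟩
  left_inv := by rintro ⟨_, _, t⟩; cases t; rfl
  right_inv _ := rfl

/-- An initialization has one transition. -/
def stepsInit (q : Var) (ρ : Op ty) : Steps (.init q) ρ ≃ Unit where
  toFun _ := ()
  invFun _ := ⟨_, _, .init q ρ⟩
  left_inv := by rintro ⟨_, _, t⟩; cases t; rfl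
  right_inv _ := rfl

/-- A unitary transformation has one transition. -/
def stepsUnitary {n : ℕ} (r : Fin n ↪ Var) (U : RegOp ty r) (hU : U† ∘L U = 1) (ρ : Op ty) :
    Steps (.unitary r U hU) ρ ≃ Unit where
  toFun _ := ()
  invFun _ := ⟨_, _, .unitary r U hU ρ⟩
  left_inv := by rintro ⟨_, _, t⟩; cases t; rfl
  right_inv _ := rfl

/-- The transitions of `S₁; S₂` are those of `S₁`. -/
def stepsSeq (S₁ S₂ : Prog ty) (ρ : Op ty) : Steps (.seq S₁ S₂) ρ ≃ Steps S₁ ρ where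
  toFun := fun ⟨_, _, t⟩ => match t with
    | .seq t _ => ⟨_, _, t⟩
  invFun := fun ⟨_, _, t⟩ => ⟨_, _, t.seq S₂⟩
  left_inv := by rintro ⟨_, _, t⟩; cases t; rfl
  right_inv := by rintro ⟨_, _, t⟩; rfl

/-- The transitions of a measurement are its outcomes. -/
def stepsMeasure {n : ℕ} (r : Fin n ↪ Var) {ι : Type} (M : ι → RegOp ty r)
    (hM : IsMeasurement M) (S : ι → Prog ty) (ρ : Op ty) : Steps (.measure r M hM S) ρ ≃ ι where
  toFun := fun ⟨_, _, t⟩ => match t with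
    | .measure _ _ _ _ m _ => m
  invFun m := ⟨_, _, .measure r M hM S m ρ⟩
  left_inv := by rintro ⟨_, _, t⟩; cases t; rfl
  right_inv _ := rfl

/-- A loop has two transitions. -/
def stepsLoop {n : ℕ} (r : Fin n ↪ Var) (M : Fin 2 → RegOp ty r)
    (hM : IsMeasurement M) (S : Prog ty) (ρ : Op ty) : Steps (.loop r M hM S) ρ ≃ Bool where
  toFun := fun ⟨_, _, t⟩ => match t with
    | .loop0 .. => false
    | .loop1 .. => true
  invFun b := match b with
    | false => ⟨_, _, .loop0 r M hM S ρ⟩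
    | true => ⟨_, _, .loop1 r M hM S ρ⟩
  left_inv := by rintro ⟨_, _, t⟩; cases t <;> rfl
  right_inv b := by cases b <;> rfl

/-- The sum of `g ρ'` over the terminating computations `⟨C, ρ⟩ →* ⟨E, ρ'⟩`. -/
def outcomeSum (C : Option (Prog ty)) (ρ : Op ty) (g : Op ty → ℝ≥0∞) : ℝ≥0∞ :=
  ∑' k : Outcomes C ρ, g k.1

lemma outcomeSum_none (ρ : Op ty) (g : Op ty → ℝ≥0∞) : outcomeSum none ρ g = g ρ := by
  rw [outcomeSum, ← (outcomesNone ρ).symm.tsum_eq]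
  simp [outcomesNone]

lemma outcomeSum_some (S : Prog ty) (ρ : Op ty) (g : Op ty → ℝ≥0∞) :
    outcomeSum (some S) ρ g = ∑' s : Steps S ρ, outcomeSum s.1 s.2.1 g := by
  rw [outcomeSum, ← (outcomesSome S ρ).symm.tsum_eq, ENNReal.tsum_sigma']
  rfl

lemma outcomeSum_add (C : Option (Prog ty)) (ρ : Op ty) (f g : Op ty → ℝ≥0∞) :
    outcomeSum C ρ (fun σ => f σ + g σ) = outcomeSum C ρ f + outcomeSum C ρ g :=
  ENNReal.tsum_add

lemma outcomeSum_mono (C : Option (Prog ty)) (ρ : Op ty) {f g : Op ty → ℝ≥0∞}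
    (h : ∀ σ, f σ ≤ g σ) : outcomeSum C ρ f ≤ outcomeSum C ρ g :=
  ENNReal.tsum_le_tsum fun _ => h _

/-- The part of `outcomeSum` coming from computations of at most `n` steps. -/
def boundedSum : ℕ → Option (Prog ty) → Op ty → (Op ty → ℝ≥0∞) → ℝ≥0∞
  | _, none, ρ, g => g ρ
  | 0, some _, _, _ => 0
  | n + 1, some S, ρ, g => ∑' s : Steps S ρ, boundedSum n s.1 s.2.1 g

lemma boundedSum_none (n : ℕ) (ρ : Op ty) (g : Op ty → ℝ≥0∞) : boundedSum n none ρ g = g ρ := by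
  cases n <;> rfl

/-- The number of steps of a computation. -/
def Computation.length {C : Option (Prog ty)} {ρ ρ' : Op ty} : Computation C ρ ρ' → ℕ
  | .done _ => 0
  | .step _ k => k.length + 1

lemma boundedSum_eq_tsum (n : ℕ) (C : Option (Prog ty)) (ρ : Op ty) (g : Op ty → ℝ≥0∞) :
    boundedSum n C ρ g = ∑' k : Outcomes C ρ, if k.2.length ≤ n then g k.1 else 0 := by
  induction n generalizing C ρ with
  | zero =>
    cases C with
    | none =>
      rw [← (outcomesNone ρ).symm.tsum_eq]
      simp [outcomesNone, boundedSum, Computation.length]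
    | some S =>
      rw [← (outcomesSome S ρ).symm.tsum_eq]
      simp [outcomesSome, boundedSum, Computation.length]
  | succ n ih =>
    cases C with
    | none =>
      rw [← (outcomesNone ρ).symm.tsum_eq]
      simp [outcomesNone, boundedSum, Computation.length]
    | some S =>
      rw [← (outcomesSome S ρ).symm.tsum_eq, ENNReal.tsum_sigma', boundedSum]
      refine tsum_congr fun s => ?_
      rw [ih]
      simp [outcomesSome, Computation.length]

/-- Each computation has finite length, so every term is eventually counted; monotonicity lets the
supremum pass through finite sums. Statements about all computations thereby reduce to induction on
the number of steps. -/
lemma outcomeSum_eq_iSup (C : Option (Prog ty)) (ρ : Op ty) (g : Op ty → ℝ≥0∞) :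
    outcomeSum C ρ g = ⨆ n, boundedSum n C ρ g := by
  have hmono : ∀ k : Outcomes C ρ, Monotone fun n => if k.2.length ≤ n then g k.1 else 0 :=
    fun k m n hmn => by
      by_cases h : k.2.length ≤ m
      · simp [h, h.trans hmn]
      · simp [h]
  have h : ∀ k : Outcomes C ρ, g k.1 = ⨆ n, if k.2.length ≤ n then g k.1 else 0 := fun k =>
    le_antisymm (le_iSup_of_le k.2.length (by simp)) (iSup_le fun n => by split_ifs <;> simp)
  simp_rw [boundedSum_eq_tsum, ENNReal.tsum_eq_iSup_sum]
  rw [iSup_comm, outcomeSum, ENNReal.tsum_eq_iSup_sum]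
  refine iSup_congr fun s => ?_
  rw [← ENNReal.finsetSum_iSup_of_monotone hmono]
  exact Finset.sum_congr rfl fun k _ => h k

lemma boundedSum_le (n : ℕ) (C : Option (Prog ty)) (ρ : Op ty) (g : Op ty → ℝ≥0∞) :
    boundedSum n C ρ g ≤ outcomeSum C ρ g := by
  rw [outcomeSum_eq_iSup]
  exact le_iSup (fun n => boundedSum n C ρ g) n

lemma boundedSum_le_succ (n : ℕ) (C : Option (Prog ty)) (ρ : Op ty) (g : Op ty → ℝ≥0∞) :
    boundedSum n C ρ g ≤ boundedSum (n + 1) C ρ g := by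
  simp_rw [boundedSum_eq_tsum]
  refine ENNReal.tsum_le_tsum fun k => ?_
  by_cases h : k.2.length ≤ n
  · simp [h, h.trans n.le_succ]
  · simp [h]

/-- A computation of the composite within `n` steps runs `C` to its end and then `T` within `n`
steps. With the reverse bound `le_outcomeSum_andThen`, this replaces an explicit bijection with
pairs of computations. -/
lemma boundedSum_andThen_le (n : ℕ) (C : Option (Prog ty)) (T : Prog ty) (ρ : Op ty)
    (g : Op ty → ℝ≥0∞) :
    boundedSum n (some (andThen C T)) ρ g ≤
      outcomeSum C ρ fun σ => boundedSum n (some T) σ g := by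
  induction n generalizing C ρ with
  | zero => simp [boundedSum]
  | succ n ih =>
    cases C with
    | none => rw [outcomeSum_none]; rfl
    | some S =>
      rw [outcomeSum_some]
      change ∑' s : Steps (.seq S T) ρ, boundedSum n s.1 s.2.1 g ≤ _
      rw [← (stepsSeq S T ρ).symm.tsum_eq]
      -- The induction hypothesis allows `T` only `n` steps; this is relaxed to `n + 1`.
      exact ENNReal.tsum_le_tsum fun s => (ih s.1 s.2.1).trans
        (outcomeSum_mono _ _ fun σ => boundedSum_le_succ n _ σ g)

/-- Only the steps of `C` are bounded here; `T` runs without restriction, so the induction never has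
to follow it. -/
lemma le_outcomeSum_andThen (n : ℕ) (C : Option (Prog ty)) (T : Prog ty) (ρ : Op ty)
    (g : Op ty → ℝ≥0∞) :
    boundedSum n C ρ (fun σ => outcomeSum (some T) σ g) ≤
      outcomeSum (some (andThen C T)) ρ g := by
  induction n generalizing C ρ with
  | zero => cases C <;> simp [boundedSum, andThen]
  | succ n ih =>
    cases C with
    | none => rfl
    | some S =>
      change _ ≤ outcomeSum (some (.seq S T)) ρ g
      rw [outcomeSum_some, ← (stepsSeq S T ρ).symm.tsum_eq, boundedSum]
      exact ENNReal.tsum_le_tsum fun s => ih s.1 s.2.1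

lemma outcomeSum_seq (S T : Prog ty) (ρ : Op ty) (g : Op ty → ℝ≥0∞) :
    outcomeSum (some (.seq S T)) ρ g =
      outcomeSum (some S) ρ fun σ => outcomeSum (some T) σ g := by
  apply le_antisymm
  · rw [outcomeSum_eq_iSup]
    exact iSup_le fun n => (boundedSum_andThen_le n (some S) T ρ g).trans
      (outcomeSum_mono _ _ fun σ => boundedSum_le n _ σ g)
  · rw [outcomeSum_eq_iSup (some S)]
    exact iSup_le fun n => le_outcomeSum_andThen n (some S) T ρ g

lemma outcomeSum_skip (ρ : Op ty) (g : Op ty → ℝ≥0∞) : outcomeSum (some .skip) ρ g = g ρ := by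
  rw [outcomeSum_some, ← (stepsSkip ρ).symm.tsum_eq]
  simp [stepsSkip, outcomeSum_none]

lemma outcomeSum_init (q : Var) (ρ : Op ty) (g : Op ty → ℝ≥0∞) :
    outcomeSum (some (.init q)) ρ g = g (initState q ρ) := by
  rw [outcomeSum_some, ← (stepsInit q ρ).symm.tsum_eq]
  simp [stepsInit, outcomeSum_none]

lemma outcomeSum_unitary {n : ℕ} (r : Fin n ↪ Var) (U : RegOp ty r) (hU : U† ∘L U = 1)
    (ρ : Op ty) (g : Op ty → ℝ≥0∞) :
    outcomeSum (some (.unitary r U hU)) ρ g = g (cyl r U ∘L ρ ∘L (cyl r U)†) := by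
  rw [outcomeSum_some, ← (stepsUnitary r U hU ρ).symm.tsum_eq]
  simp [stepsUnitary, outcomeSum_none]

lemma outcomeSum_measure {n : ℕ} (r : Fin n ↪ Var) {ι : Type} (M : ι → RegOp ty r)
    (hM : IsMeasurement M) (S : ι → Prog ty) (ρ : Op ty) (g : Op ty → ℝ≥0∞) :
    outcomeSum (some (.measure r M hM S)) ρ g =
      ∑' m, outcomeSum (some (S m)) (cyl r (M m) ∘L ρ ∘L (cyl r (M m))†) g := by
  rw [outcomeSum_some, ← (stepsMeasure r M hM S ρ).symm.tsum_eq]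
  rfl

/-! ### Computations of a loop, counted by iterations -/

section Loop

variable {n : ℕ} (r : Fin n ↪ Var) (M : Fin 2 → RegOp ty r) (hM : IsMeasurement M) (S : Prog ty)

/-- The part of `outcomeSum` of a loop coming from computations with less than `k` iterations. -/
def loopSum : ℕ → Op ty → (Op ty → ℝ≥0∞) → ℝ≥0∞
  | 0, _, _ => 0
  | k + 1, ρ, g => g (cyl r (M 0) ∘L ρ ∘L (cyl r (M 0))†) +
      outcomeSum (some S) (cyl r (M 1) ∘L ρ ∘L (cyl r (M 1))†) fun σ => loopSum k σ g

lemma outcomeSum_loop (ρ : Op ty) (g : Op ty → ℝ≥0∞) :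
    outcomeSum (some (.loop r M hM S)) ρ g = g (cyl r (M 0) ∘L ρ ∘L (cyl r (M 0))†) +
      outcomeSum (some S) (cyl r (M 1) ∘L ρ ∘L (cyl r (M 1))†)
        fun σ => outcomeSum (some (.loop r M hM S)) σ g := by
  rw [outcomeSum_some, ← (stepsLoop r M hM S ρ).symm.tsum_eq, tsum_bool, ← outcomeSum_seq]
  exact congrArg (· + _) (outcomeSum_none _ g)

lemma loopSum_le_outcomeSum (k : ℕ) (ρ : Op ty) (g : Op ty → ℝ≥0∞) :
    loopSum r M S k ρ g ≤ outcomeSum (some (.loop r M hM S)) ρ g := by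
  induction k generalizing ρ with
  | zero => simp [loopSum]
  | succ k ih =>
    rw [outcomeSum_loop, loopSum]
    exact add_le_add_right (outcomeSum_mono _ _ ih) _

/-- Every iteration costs at least its measurement step, and leaving the loop costs one more, so `k`
steps allow fewer than `k` iterations. -/
lemma boundedSum_le_loopSum (k : ℕ) (ρ : Op ty) (g : Op ty → ℝ≥0∞) :
    boundedSum k (some (.loop r M hM S)) ρ g ≤ loopSum r M S k ρ g := by
  induction k generalizing ρ with
  | zero => simp [boundedSum]
  | succ k ih =>
    rw [boundedSum, ← (stepsLoop r M hM S ρ).symm.tsum_eq, tsum_bool, loopSum]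
    refine add_le_add (boundedSum_none k _ g).le ?_
    exact (boundedSum_andThen_le k (some S) (.loop r M hM S) _ g).trans (outcomeSum_mono _ _ ih)

lemma loopSum_mono (ρ : Op ty) (g : Op ty → ℝ≥0∞) : Monotone fun k => loopSum r M S k ρ g := by
  refine monotone_nat_of_le_succ fun k => ?_
  induction k generalizing ρ with
  | zero => simp [loopSum]
  | succ k ih =>
    rw [loopSum, loopSum]
    exact add_le_add_right (outcomeSum_mono _ _ ih) _

lemma tendsto_loopSum (ρ : Op ty) (g : Op ty → ℝ≥0∞) :
    Tendsto (fun k => loopSum r M S k ρ g) atTop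
      (𝓝 (outcomeSum (some (.loop r M hM S)) ρ g)) := by
  have h : outcomeSum (some (.loop r M hM S)) ρ g = ⨆ k, loopSum r M S k ρ g := by
    apply le_antisymm
    · rw [outcomeSum_eq_iSup]
      exact iSup_mono fun k => boundedSum_le_loopSum r M hM S k ρ g
    · exact iSup_le fun k => loopSum_le_outcomeSum r M hM S k ρ g
  rw [h]
  exact tendsto_atTop_iSup (loopSum_mono r M S ρ g)

end Loop

end Computations

/-! ## Cylinder extensions of measurements -/

section CylinderMeasurement

variable {Var : Type*} {ty : Var → QType} {n : ℕ} (r : Fin n ↪ Var)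

/-- A cylinder operator acts on each slice separately, so adjoints and norm identities transfer from
the register by summing over slices. -/
lemma slice_cyl (A : RegOp ty r) (ψ : Hall ty) (c : Conf ty) :
    slice r (cyl r A ψ) c = A (slice r ψ c) := by
  apply lp.ext
  funext x
  rw [slice_apply, cyl_apply, slice_override, Conf.restrict_override]

lemma tsum_enorm_slice (ψ : Hall ty) :
    ∑' c : {c : Conf ty // c.restrict r = 0}, ‖slice r ψ c.1‖ₑ ^ 2 = ‖ψ‖ₑ ^ 2 := by
  have h := hasSum_norm_slice r ψ
  simp_rw [enorm_sq_eq_ofReal]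
  rw [← h.tsum_eq, ENNReal.ofReal_tsum_of_nonneg (fun _ => by positivity) h.summable]

lemma hasSum_inner_slice (φ ψ : Hall ty) :
    HasSum (fun c : {c : Conf ty // c.restrict r = 0} => inner ℂ (slice r φ c.1) (slice r ψ c.1))
      (inner ℂ φ ψ) := by
  have h := (Conf.split r).symm.hasSum_iff.2 (lp.hasSum_inner (𝕜 := ℂ) φ ψ)
  exact h.prod_fiberwise fun c => lp.hasSum_inner (𝕜 := ℂ) (slice r φ c.1) (slice r ψ c.1)

lemma cyl_adjoint (A : RegOp ty r) : (cyl r A)† = cyl r (A†) := by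
  symm
  rw [ContinuousLinearMap.eq_adjoint_iff]
  intro φ ψ
  refine (hasSum_inner_slice r _ _).unique ((hasSum_inner_slice r _ _).congr_fun fun c => ?_)
  rw [slice_cyl, slice_cyl, ContinuousLinearMap.adjoint_inner_left]

/-- If `∑ ‖Aᵢ φ‖² = ‖φ‖²` on the register, the same holds for the cylinder extensions. -/
lemma tsum_enorm_cyl {ι : Type*} {A : ι → RegOp ty r}
    (hA : ∀ φ, ∑' i, ‖A i φ‖ₑ ^ 2 = ‖φ‖ₑ ^ 2) (ψ : Hall ty) :
    ∑' i, ‖cyl r (A i) ψ‖ₑ ^ 2 = ‖ψ‖ₑ ^ 2 := by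
  simp_rw [← tsum_enorm_slice r, slice_cyl]
  rw [ENNReal.tsum_comm]
  simp_rw [hA]

variable {r}

lemma IsMeasurement.tsum_enorm {ι : Type} {M : ι → RegOp ty r} (hM : IsMeasurement M)
    (φ : RegSpace ty r) : ∑' m, ‖M m φ‖ₑ ^ 2 = ‖φ‖ₑ ^ 2 := by
  have h := qf_eq_tsum_of_hasSum (V := 1) (A := fun m => (M m)† ∘L M m)
    (fun m => (ContinuousLinearMap.nonneg_iff_isPositive _).2
      (ContinuousLinearMap.isPositive_adjoint_comp_self (M m))) (hM φ)
  rw [qf_one] at h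
  rw [h]
  refine tsum_congr fun m => ?_
  have := qf_conj (M m) 1 φ
  rw [qf_one] at this
  exact this.symm

lemma IsMeasurement.tsum_enorm_cyl {ι : Type} {M : ι → RegOp ty r} (hM : IsMeasurement M)
    (ψ : Hall ty) : ∑' m, ‖cyl r (M m) ψ‖ₑ ^ 2 = ‖ψ‖ₑ ^ 2 :=
  QuantumProg.tsum_enorm_cyl r hM.tsum_enorm ψ

/-- An isometry is treated as a measurement with a single outcome. -/
lemma enorm_cyl_of_isometry {U : RegOp ty r} (hU : U† ∘L U = 1) (ψ : Hall ty) :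
    ‖cyl r U ψ‖ₑ ^ 2 = ‖ψ‖ₑ ^ 2 := by
  have h := tsum_enorm_cyl r (ι := Unit) (A := fun _ => U) (fun φ => by
    have h1 := qf_conj U 1 φ
    have h2 : U† ∘L (1 : RegOp ty r) ∘L U = 1 := hU
    rw [h2, qf_one, qf_one] at h1
    simpa using h1.symm) ψ
  simpa using h

lemma enorm_ket {X : Type*} (x : X) : ‖(ket x : L2 X)‖ₑ = 1 := by
  classical
  rw [← ofReal_norm, ket, lp.norm_single (by norm_num)]
  simp

lemma ketbra_adjoint (q : Var) (a b : Val (ty q)) : (ketbra q a b)† = ketbra q b a := by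
  rw [ketbra, cyl_adjoint, InnerProductSpace.adjoint_rankOne]
  rfl

/-- On the one-variable register, `|0⟩⟨k|` extracts the coordinate at `k`, so this is Parseval's
identity. Initialization thus behaves like a measurement whose outcomes are added up. -/
lemma tsum_enorm_ketbra (q : Var) (ψ : Hall ty) :
    ∑' k : Val (ty q), ‖ketbra q 0 k ψ‖ₑ ^ 2 = ‖ψ‖ₑ ^ 2 := by
  refine tsum_enorm_cyl (single q) (fun φ => ?_) ψ
  let e : Val (ty q) ≃ RegVal ty (single q) :=
    { toFun := singleVal q
      invFun := fun x => x 0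
      left_inv := fun _ => rfl
      right_inv := fun x => by
        funext i
        obtain rfl : i = 0 := Subsingleton.elim _ _
        rfl }
  rw [← L2.tsum_enorm_sq φ, ← e.tsum_eq]
  refine tsum_congr fun k => ?_
  rw [InnerProductSpace.rankOne_apply, inner_ket, enorm_smul, enorm_ket, mul_one]
  rfl

end CylinderMeasurement

/-- A sum over the values of a Boolean variable has two terms. -/
lemma hasSum_val_boolean {E : Type*} [AddCommMonoid E] [TopologicalSpace E] {t : QType}
    (ht : t = .boolean) (f : Val t → E) : HasSum f (f 0 + f 1) := by
  subst ht
  have h : ∀ g : Fin 2 → E, HasSum g (g 0 + g 1) := fun g => by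
    simpa using hasSum_fintype g
  exact h f

/-! ## States, weakest liberal preconditions and the trace identity -/

section TraceIdentity

variable {Var : Type*} {ty : Var → QType}

/-- Positive operators of finite trace. -/
def IsState (ρ : Op ty) : Prop := 0 ≤ ρ ∧ etr 1 ρ ≠ ∞

lemma isPartialDensity_iff {ρ : Op ty} : IsPartialDensity ρ ↔ 0 ≤ ρ ∧ etr 1 ρ ≤ 1 := by
  have htr : ∀ {ρ : Op ty}, 0 ≤ ρ → etr 1 ρ ≠ ∞ →
      HasSum (fun c => inner ℂ (ket c) (ρ (ket c))) ((etr 1 ρ).toReal : ℂ) := fun hρ hfin => by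
    simpa only [ContinuousLinearMap.one_def, ContinuousLinearMap.id_comp] using
      hasSum_inner_comp zero_le_one hρ hfin
  constructor
  · rintro ⟨hρ, hs, h1⟩
    have hfin : etr 1 ρ ≠ ∞ := by
      rw [etr_one]
      simp only [qf]
      rw [← ENNReal.ofReal_tsum_of_nonneg (fun c => re_inner_nonneg hρ _)
        (hs.mapL Complex.reCLM)]
      exact ENNReal.ofReal_ne_top
    refine ⟨hρ, ?_⟩
    rw [trace, (htr hρ hfin).tsum_eq, Complex.ofReal_re] at h1
    rw [← ENNReal.ofReal_toReal hfin]
    exact ENNReal.ofReal_le_one.2 h1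
  · rintro ⟨hρ, h1⟩
    have hfin : etr 1 ρ ≠ ∞ := ne_top_of_le_ne_top ENNReal.one_ne_top h1
    refine ⟨hρ, (htr hρ hfin).summable, ?_⟩
    rw [trace, (htr hρ hfin).tsum_eq, Complex.ofReal_re]
    exact ENNReal.toReal_le_of_le_ofReal zero_le_one (by simpa using h1)

lemma IsPartialDensity.isState {ρ : Op ty} (h : IsPartialDensity ρ) : IsState ρ :=
  ⟨h.1, ne_top_of_le_ne_top ENNReal.one_ne_top (isPartialDensity_iff.1 h).2⟩

lemma IsState.trace_comp {P ρ : Op ty} (hρ : IsState ρ) (hP : 0 ≤ P) :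
    trace (P ∘L ρ) = ((etr P ρ).toReal : ℂ) :=
  (hasSum_inner_comp hP hρ.1 hρ.2).tsum_eq

lemma IsState.trace_eq {ρ : Op ty} (hρ : IsState ρ) : trace ρ = ((etr 1 ρ).toReal : ℂ) :=
  hρ.trace_comp (P := 1) zero_le_one

lemma IsState.etr_ne_top {P ρ : Op ty} (hρ : IsState ρ) (hP : IsPredicate P) : etr P ρ ≠ ∞ :=
  ne_top_of_le_ne_top hρ.2 (etr_mono hP.1 hP.2 hρ.1)

lemma isPredicate_one : IsPredicate (1 : Op ty) := ⟨zero_le_one, le_rfl⟩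

lemma isPredicate_zero : IsPredicate (0 : Op ty) := ⟨le_rfl, zero_le_one⟩

lemma etr_one_eq_tsum_conj {ι : Type*} {K : ι → Op ty}
    (hK : ∀ x, ∑' i, ‖K i x‖ₑ ^ 2 = ‖x‖ₑ ^ 2) {ρ : Op ty} (hρ : 0 ≤ ρ) :
    etr 1 ρ = ∑' i, etr 1 (K i ∘L ρ ∘L (K i)†) :=
  etr_eq_tsum_conj zero_le_one (fun _ => zero_le_one) hρ fun x => by simp only [qf_one, hK]

lemma IsState.conj {ι : Type*} {K : ι → Op ty} (hK : ∀ x, ∑' i, ‖K i x‖ₑ ^ 2 = ‖x‖ₑ ^ 2)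
    {ρ : Op ty} (hρ : IsState ρ) (i : ι) : IsState (K i ∘L ρ ∘L (K i)†) := by
  refine ⟨conj_nonneg hρ.1 _, ne_top_of_le_ne_top hρ.2 ?_⟩
  rw [etr_one_eq_tsum_conj hK hρ.1]
  exact ENNReal.le_tsum i

lemma isState_of_hasSum {κ : Type*} {σ : κ → Op ty} {ρ : Op ty} (hσ : ∀ k, 0 ≤ σ k)
    (h : HasSum σ ρ) (hfin : ∑' k, etr 1 (σ k) ≠ ∞) : IsState ρ := by
  refine ⟨nonneg_of_tendsto (l := atTop) (A := fun s : Finset κ => ∑ k ∈ s, σ k)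
    (.of_forall fun s => Finset.sum_nonneg fun k _ => hσ k) fun x => ?_, ?_⟩
  · exact ((ContinuousLinearMap.apply ℂ (Hall ty) x).continuous.tendsto ρ).comp h
  · rwa [etr_hasSum_right hσ h]

lemma hasSum_initState (q : Var) {ρ : Op ty} (hρ : IsState ρ) :
    HasSum (fun k : Val (ty q) => ketbra q 0 k ∘L ρ ∘L (ketbra q 0 k)†) (initState q ρ) := by
  have hs := summable_of_tsum_etr_one
    (fun k : Val (ty q) => conj_nonneg hρ.1 (ketbra q 0 k))
    (by rw [← etr_one_eq_tsum_conj (tsum_enorm_ketbra q) hρ.1]; exact hρ.2)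
  have h : initState q ρ = ∑' k : Val (ty q), ketbra q 0 k ∘L ρ ∘L (ketbra q 0 k)† :=
    tsum_congr fun k => by rw [ketbra_adjoint]
  rw [h]
  exact hs.hasSum

lemma etr_initState (q : Var) {ρ : Op ty} (hρ : IsState ρ) (P : Op ty) :
    etr P (initState q ρ) = ∑' k : Val (ty q), etr P (ketbra q 0 k ∘L ρ ∘L (ketbra q 0 k)†) :=
  etr_hasSum_right (fun _ => conj_nonneg hρ.1 _) (hasSum_initState q hρ) P

lemma etr_one_initState (q : Var) {ρ : Op ty} (hρ : IsState ρ) :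
    etr 1 (initState q ρ) = etr 1 ρ := by
  rw [etr_initState q hρ, ← etr_one_eq_tsum_conj (tsum_enorm_ketbra q) hρ.1]

lemma IsState.initState (q : Var) {ρ : Op ty} (hρ : IsState ρ) : IsState (initState q ρ) :=
  isState_of_hasSum (fun _ => conj_nonneg hρ.1 _) (hasSum_initState q hρ)
    (by rw [← etr_one_eq_tsum_conj (tsum_enorm_ketbra q) hρ.1]; exact hρ.2)

lemma tsum_enorm_unitary {n : ℕ} {r : Fin n ↪ Var} {U : RegOp ty r} (hU : U† ∘L U = 1)
    (ψ : Hall ty) : ∑' _ : Unit, ‖cyl r U ψ‖ₑ ^ 2 = ‖ψ‖ₑ ^ 2 := by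
  simpa using enorm_cyl_of_isometry hU ψ

lemma Step.isState {S : Prog ty} {ρ ρ' : Op ty} {C : Option (Prog ty)} (t : Step S ρ C ρ') :
    IsState ρ → IsState ρ' := by
  induction t with
  | skip => exact id
  | init q ρ => exact fun h => h.initState q
  | unitary r U hU ρ => exact fun h => h.conj (tsum_enorm_unitary hU) ()
  | seq t S₂ ih => exact ih
  | measure r M hM S m ρ => exact fun h => h.conj hM.tsum_enorm_cyl m
  | loop0 r M hM S ρ => exact fun h => h.conj hM.tsum_enorm_cyl 0
  | loop1 r M hM S ρ => exact fun h => h.conj hM.tsum_enorm_cyl 1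

lemma Computation.isState {C : Option (Prog ty)} {ρ ρ' : Op ty} (k : Computation C ρ ρ') :
    IsState ρ → IsState ρ' := by
  induction k with
  | done => exact id
  | step t _ ih => exact fun h => ih (t.isState h)

lemma IsState.outcomeSum_congr {C : Option (Prog ty)} {ρ : Op ty} (hρ : IsState ρ)
    {f g : Op ty → ℝ≥0∞} (h : ∀ σ, IsState σ → f σ = g σ) :
    outcomeSum C ρ f = outcomeSum C ρ g :=
  tsum_congr fun k => h _ (k.2.isState hρ)

lemma IsState.outcomeSum_le {C : Option (Prog ty)} {ρ : Op ty} (hρ : IsState ρ)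
    {f g : Op ty → ℝ≥0∞} (h : ∀ σ, IsState σ → f σ ≤ g σ) :
    outcomeSum C ρ f ≤ outcomeSum C ρ g :=
  ENNReal.tsum_le_tsum fun k => h _ (k.2.isState hρ)

/-- The identity `tr(Wρ) + tr(⟦S⟧ρ) = tr(P⟦S⟧ρ) + tr(ρ)`. -/
def TraceIdentity (S : Prog ty) (P W : Op ty) : Prop :=
  ∀ ρ, IsState ρ →
    etr W ρ + outcomeSum (some S) ρ (etr 1) = outcomeSum (some S) ρ (etr P) + etr 1 ρ

/-- Programs do not increase the trace. -/
def TraceNonincreasing (S : Prog ty) : Prop :=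
  ∀ ρ, IsState ρ → outcomeSum (some S) ρ (etr 1) ≤ etr 1 ρ

/-- For the predicate `0` the right side of the identity is just the initial trace; drop the term of
`W` on the left. -/
lemma TraceIdentity.traceNonincreasing {S : Prog ty} {W : Op ty} (h : TraceIdentity S 0 W) :
    TraceNonincreasing S := fun ρ hρ => by
  have h0 : outcomeSum (some S) ρ (etr 0) = 0 := by
    rw [hρ.outcomeSum_congr (g := fun _ => 0) fun σ hσ => etr_zero_left hσ.1]
    exact tsum_zero
  rw [← zero_add (etr 1 ρ), ← h0, ← h ρ hρ]
  exact le_add_self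

/-! ### The denotational semantics: convergence and traces -/

section Semantics

variable {S : Prog ty} {ρ : Op ty}

lemma TraceNonincreasing.ne_top (hS : TraceNonincreasing S) (hρ : IsState ρ) {P : Op ty}
    (hP : IsPredicate P) : outcomeSum (some S) ρ (etr P) ≠ ∞ :=
  ne_top_of_le_ne_top hρ.2
    ((hρ.outcomeSum_le fun _ hσ => etr_mono hP.1 hP.2 hσ.1).trans (hS ρ hρ))

/-- The final states have finite total trace, and trace dominates operator norm. -/
lemma TraceNonincreasing.hasSum_sem (hS : TraceNonincreasing S) (hρ : IsState ρ) :
    HasSum (fun k : Outcomes (some S) ρ => k.1) (sem S ρ) :=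
  (summable_of_tsum_etr_one (fun k => (k.2.isState hρ).1)
    (hS.ne_top hρ isPredicate_one)).hasSum

lemma TraceNonincreasing.isState_sem (hS : TraceNonincreasing S) (hρ : IsState ρ) :
    IsState (sem S ρ) :=
  isState_of_hasSum (fun k => (k.2.isState hρ).1) (hS.hasSum_sem hρ)
    (hS.ne_top hρ isPredicate_one)

lemma TraceNonincreasing.etr_sem (hS : TraceNonincreasing S) (hρ : IsState ρ) (P : Op ty) :
    etr P (sem S ρ) = outcomeSum (some S) ρ (etr P) :=
  etr_hasSum_right (fun k => (k.2.isState hρ).1) (hS.hasSum_sem hρ) P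

lemma TraceIdentity.trace_eq (hS : TraceNonincreasing S) {P W : Op ty} (hP : IsPredicate P)
    (hW : IsPredicate W) (h : TraceIdentity S P W) (hρ : IsState ρ) :
    trace (W ∘L ρ) = trace (P ∘L sem S ρ) + (trace ρ - trace (sem S ρ)) := by
  have hsem := hS.isState_sem hρ
  rw [hρ.trace_comp hW.1, hρ.trace_eq, hsem.trace_comp hP.1, hsem.trace_eq,
    hS.etr_sem hρ, hS.etr_sem hρ]
  have h1 := congrArg ENNReal.toReal (h ρ hρ)
  rw [ENNReal.toReal_add (hρ.etr_ne_top hW) (hS.ne_top hρ isPredicate_one),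
    ENNReal.toReal_add (hS.ne_top hρ hP) hρ.2] at h1
  norm_cast
  linarith

/-- All four terms are finite, so the real inequality can be rearranged without subtraction and
moved to `[0, ∞]`. -/
lemma partialCorrect_iff (hS : TraceNonincreasing S) {P Q : Op ty} (hP : IsPredicate P)
    (hQ : IsPredicate Q) : PartialCorrect Q S P ↔ ∀ ρ, IsPartialDensity ρ →
      etr Q ρ + outcomeSum (some S) ρ (etr 1) ≤ outcomeSum (some S) ρ (etr P) + etr 1 ρ := by
  refine forall₂_congr fun ρ hd => ?_
  have hρ := hd.isState
  have hsem := hS.isState_sem hρ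
  rw [hρ.trace_comp hQ.1, hρ.trace_eq, hsem.trace_comp hP.1, hsem.trace_eq,
    hS.etr_sem hρ, hS.etr_sem hρ, ← ENNReal.toReal_le_toReal
      (ENNReal.add_ne_top.2 ⟨hρ.etr_ne_top hQ, hS.ne_top hρ isPredicate_one⟩)
      (ENNReal.add_ne_top.2 ⟨hS.ne_top hρ hP, hρ.2⟩),
    ENNReal.toReal_add (hρ.etr_ne_top hQ) (hS.ne_top hρ isPredicate_one),
    ENNReal.toReal_add (hS.ne_top hρ hP) hρ.2]
  simp only [Complex.ofReal_re]
  constructor <;> intro h <;> linarith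

end Semantics

/-! ### Pure states and uniqueness of the weakest liberal precondition -/

lemma qf_smul (A : Op ty) (a : ℂ) (x : Hall ty) : qf A (a • x) = ‖a‖ₑ ^ 2 * qf A x := by
  rw [enorm_sq_eq_ofReal, qf, qf, ← ENNReal.ofReal_mul (by positivity), map_smul,
    inner_smul_left, inner_smul_right, ← mul_assoc, mul_comm _ a, RCLike.mul_conj]
  norm_cast
  exact congrArg ENNReal.ofReal (Complex.re_ofReal_mul _ _)

instance : Nonempty (Conf ty) := ⟨⟨0, by simp⟩⟩

lemma etr_rankOne {Q : Op ty} (hQ : 0 ≤ Q) (ψ : Hall ty) :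
    etr Q (InnerProductSpace.rankOne ℂ ψ ψ) = qf Q ψ := by
  obtain ⟨c₀⟩ := (inferInstance : Nonempty (Conf ty))
  -- With `B = |ψ⟩⟨c₀|` the projector factors as `B ∘L B†`, and `B` kills every basis vector except
  -- `ket c₀`; the choice of `c₀` is immaterial.
  set B : Op ty := InnerProductSpace.rankOne ℂ ψ (ket c₀) with hB
  have h : InnerProductSpace.rankOne ℂ ψ ψ = B ∘L B† := by
    rw [hB, InnerProductSpace.adjoint_rankOne, InnerProductSpace.rankOne_comp_rankOne, inner_ket,
      ket_apply_self, one_smul]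
  rw [h, etr_self_comp_adjoint hQ, tsum_eq_single c₀]
  · rw [hB, InnerProductSpace.rankOne_apply, inner_ket, ket_apply_self, one_smul]
  · intro c hc
    rw [hB, InnerProductSpace.rankOne_apply, inner_ket, ket_apply_ne hc.symm, zero_smul]
    simp [qf]

/-- Pairing with a pure state recovers the quadratic form; vectors are first scaled to unit norm to
obtain a partial density operator. -/
lemma le_of_forall_etr_le {A B : Op ty} (hA : 0 ≤ A) (hB : 0 ≤ B)
    (h : ∀ ρ, IsPartialDensity ρ → etr A ρ ≤ etr B ρ) : A ≤ B := by
  refine (le_iff_qf hA hB).2 fun x => ?_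
  rcases eq_or_ne x 0 with rfl | hx
  · simp [qf]
  obtain ⟨a, ψ, hn, rfl⟩ : ∃ (a : ℂ) (ψ : Hall ty), ‖ψ‖ = 1 ∧ x = a • ψ := by
    have hx' := norm_ne_zero_iff.2 hx
    refine ⟨(‖x‖ : ℝ), ((‖x‖⁻¹ : ℝ) : ℂ) • x, ?_, ?_⟩
    · rw [norm_smul, Complex.norm_real, norm_inv, norm_norm, inv_mul_cancel₀ hx']
    · rw [smul_smul, ← Complex.ofReal_mul, mul_inv_cancel₀ hx', Complex.ofReal_one, one_smul]
  have hd : IsPartialDensity (InnerProductSpace.rankOne ℂ ψ ψ : Op ty) := by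
    refine isPartialDensity_iff.2 ⟨(ContinuousLinearMap.nonneg_iff_isPositive _).2
      (InnerProductSpace.isPositive_rankOne_self ψ), ?_⟩
    rw [etr_rankOne zero_le_one, qf_one, enorm_sq_eq_ofReal, hn]
    simp
  have h1 := h _ hd
  rw [etr_rankOne hA, etr_rankOne hB] at h1
  rw [qf_smul, qf_smul]
  exact mul_le_mul' le_rfl h1

lemma IsWlp.unique {S : Prog ty} {P V W : Op ty} (hV : IsWlp S P V) (hW : IsWlp S P W) : V = W :=
  le_antisymm (hW.2.2 V hV.1 hV.2.1) (hV.2.2 W hW.1 hW.2.1)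

lemma IsWlp.wlp_eq {S : Prog ty} {P W : Op ty} (hW : IsWlp S P W) : wlp S P = W :=
  (Classical.epsilon_spec ⟨W, hW⟩ : IsWlp S P (wlp S P)).unique hW

lemma TraceIdentity.isWlp {S : Prog ty} (hS : TraceNonincreasing S) {P W : Op ty}
    (hP : IsPredicate P) (hW : IsPredicate W) (h : TraceIdentity S P W) : IsWlp S P W := by
  refine ⟨hW, (partialCorrect_iff hS hP hW).2 fun ρ hρ => (h ρ hρ.isState).le, fun Q hQ hQS =>
    le_of_forall_etr_le hQ.1 hW.1 fun ρ hρ => ?_⟩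
  have h1 := (partialCorrect_iff hS hP hQ).1 hQS ρ hρ
  rw [← h ρ hρ.isState] at h1
  exact (ENNReal.add_le_add_iff_right (hS.ne_top hρ.isState isPredicate_one)).1 h1

lemma TraceIdentity.mono {S : Prog ty} (hS : TraceNonincreasing S) {P P' W W' : Op ty}
    (hP : IsPredicate P) (hW : IsPredicate W) (hW' : IsPredicate W') (h : TraceIdentity S P W)
    (h' : TraceIdentity S P' W') (hPP' : P ≤ P') : W ≤ W' := by
  refine le_of_forall_etr_le hW.1 hW'.1 fun ρ hd => ?_
  have hρ := hd.isState
  rw [← ENNReal.add_le_add_iff_right (hS.ne_top hρ isPredicate_one), h ρ hρ, h' ρ hρ]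
  gcongr
  exact hρ.outcomeSum_le fun σ hσ => etr_mono hP.1 hPP' hσ.1

/-! ## The trace identity for each program construct -/

/-- In a sequential composition `a` is the trace after the first program and `u` the weight of the
intermediate predicate. Both are finite, so they cancel when the two identities are added. -/
lemma ennreal_add_eq_add_of_cancel {w a u t b p : ℝ≥0∞} (ha : a ≠ ∞) (hu : u ≠ ∞)
    (h₁ : w + a = u + t) (h₂ : u + b = p + a) : w + b = p + t := by
  refine (ENNReal.add_left_inj (ENNReal.add_ne_top.2 ⟨ha, hu⟩)).1 ?_
  calc w + b + (a + u) = (w + a) + (u + b) := by ring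
    _ = (u + t) + (p + a) := by rw [h₁, h₂]
    _ = p + t + (a + u) := by ring

lemma traceIdentity_skip (P : Op ty) : TraceIdentity .skip P P := fun ρ _ => by
  simp only [outcomeSum_skip]

lemma traceIdentity_init (q : Var) {P W : Op ty} (hP : IsPredicate P) (hW : IsPredicate W)
    (h : ∀ ψ, HasSum (fun k : Val (ty q) => ((ketbra q 0 k)† ∘L P ∘L ketbra q 0 k) ψ) (W ψ)) :
    TraceIdentity (.init q) P W := fun ρ hρ => by
  rw [outcomeSum_init, outcomeSum_init, etr_one_initState q hρ, etr_initState q hρ]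
  congr 1
  refine etr_eq_tsum_conj hW.1 (fun _ => hP.1) hρ.1 fun x => ?_
  rw [qf_eq_tsum_of_hasSum (fun _ => adjoint_conj_nonneg hP.1 _) (h x)]
  simp_rw [qf_conj]

lemma traceIdentity_unitary {n : ℕ} (r : Fin n ↪ Var) (U : RegOp ty r) (hU : U† ∘L U = 1)
    {P : Op ty} (hP : IsPredicate P) :
    TraceIdentity (.unitary r U hU) P ((cyl r U)† ∘L P ∘L cyl r U) := fun ρ hρ => by
  rw [outcomeSum_unitary, outcomeSum_unitary, etr_conj_eq hP.1 hρ.1,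
    etr_one_eq_tsum_conj (tsum_enorm_unitary hU) hρ.1]
  simp

lemma TraceIdentity.seq {S₁ S₂ : Prog ty} (hS : TraceNonincreasing S₁) {P V W : Op ty}
    (hV : IsPredicate V) (h₁ : TraceIdentity S₁ V W) (h₂ : TraceIdentity S₂ P V) :
    TraceIdentity (.seq S₁ S₂) P W := fun ρ hρ => by
  rw [outcomeSum_seq, outcomeSum_seq]
  refine ennreal_add_eq_add_of_cancel (hS.ne_top hρ isPredicate_one) (hS.ne_top hρ hV)
    (h₁ ρ hρ) ?_
  rw [← outcomeSum_add, ← outcomeSum_add]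
  exact hρ.outcomeSum_congr h₂

lemma traceIdentity_measure {n : ℕ} (r : Fin n ↪ Var) {ι : Type} (M : ι → RegOp ty r)
    (hM : IsMeasurement M) (S : ι → Prog ty) {P V : Op ty} {W : ι → Op ty}
    (hW : ∀ m, IsPredicate (W m)) (hV : IsPredicate V) (h : ∀ m, TraceIdentity (S m) P (W m))
    (hsum : ∀ ψ, HasSum (fun m => ((cyl r (M m))† ∘L W m ∘L cyl r (M m)) ψ) (V ψ)) :
    TraceIdentity (.measure r M hM S) P V := fun ρ hρ => by
  have h1 : etr V ρ = ∑' m, etr (W m) (cyl r (M m) ∘L ρ ∘L (cyl r (M m))†) := by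
    refine etr_eq_tsum_conj hV.1 (fun m => (hW m).1) hρ.1 fun x => ?_
    rw [qf_eq_tsum_of_hasSum (fun m => adjoint_conj_nonneg (hW m).1 _) (hsum x)]
    simp_rw [qf_conj]
  rw [outcomeSum_measure, outcomeSum_measure, h1, etr_one_eq_tsum_conj hM.tsum_enorm_cyl hρ.1,
    ← ENNReal.tsum_add, ← ENNReal.tsum_add]
  exact tsum_congr fun m => h m _ (hρ.conj hM.tsum_enorm_cyl m)

/-- Weakest liberal preconditions of `S` are predicates that satisfy the trace identity. -/
def WlpSpec (S : Prog ty) : Prop :=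
  ∀ P, IsPredicate P → IsPredicate (wlp S P) ∧ TraceIdentity S P (wlp S P)

lemma WlpSpec.traceNonincreasing {S : Prog ty} (h : WlpSpec S) : TraceNonincreasing S :=
  (h 0 isPredicate_zero).2.traceNonincreasing

/-- All predicates are needed at once: the instance for `0` supplies the trace bound behind the
cancellation for every other `P`. -/
lemma wlpSpec_of_exists {S : Prog ty}
    (h : ∀ P, IsPredicate P → ∃ W, IsPredicate W ∧ TraceIdentity S P W) : WlpSpec S := by
  obtain ⟨W₀, -, h₀⟩ := h 0 isPredicate_zero
  intro P hP
  obtain ⟨W, hW, hPW⟩ := h P hP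
  rw [(hPW.isWlp h₀.traceNonincreasing hP hW).wlp_eq]
  exact ⟨hW, hPW⟩

/-! ### The approximating predicates of a loop and their limit -/

section Loop

lemma qf_add {A B : Op ty} (hA : 0 ≤ A) (hB : 0 ≤ B) (x : Hall ty) :
    qf (A + B) x = qf A x + qf B x := by
  rw [qf, qf, qf, ← ENNReal.ofReal_add (re_inner_nonneg hA x) (re_inner_nonneg hB x)]
  simp

variable {n : ℕ} {r : Fin n ↪ Var} {M : Fin 2 → RegOp ty r}

lemma IsMeasurement.enorm_cyl_add (hM : IsMeasurement M) (x : Hall ty) :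
    ‖cyl r (M 0) x‖ₑ ^ 2 + ‖cyl r (M 1) x‖ₑ ^ 2 = ‖x‖ₑ ^ 2 := by
  rw [← hM.tsum_enorm_cyl x, tsum_fintype, Fin.sum_univ_two]

lemma qf_conj_add {A B : Op ty} (hA : 0 ≤ A) (hB : 0 ≤ B) (K L : Op ty) (x : Hall ty) :
    qf (K† ∘L A ∘L K + L† ∘L B ∘L L) x = qf A (K x) + qf B (L x) := by
  rw [qf_add (adjoint_conj_nonneg hA _) (adjoint_conj_nonneg hB _), qf_conj, qf_conj]

lemma etr_conj_add {A B ρ : Op ty} (hA : 0 ≤ A) (hB : 0 ≤ B) (hρ : 0 ≤ ρ) (K L : Op ty) :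
    etr (K† ∘L A ∘L K + L† ∘L B ∘L L) ρ = etr A (K ∘L ρ ∘L K†) + etr B (L ∘L ρ ∘L L†) := by
  rw [etr_eq_tsum_qf (add_nonneg (adjoint_conj_nonneg hA _) (adjoint_conj_nonneg hB _)) hρ,
    etr_conj hA hρ, etr_conj hB hρ, ← ENNReal.tsum_add]
  exact tsum_congr fun c => qf_conj_add hA hB K L _

lemma isPredicate_conj_add (hM : IsMeasurement M) {A B : Op ty} (hA : IsPredicate A)
    (hB : IsPredicate B) :
    IsPredicate ((cyl r (M 0))† ∘L A ∘L cyl r (M 0) + (cyl r (M 1))† ∘L B ∘L cyl r (M 1)) := by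
  have h0 := add_nonneg (adjoint_conj_nonneg hA.1 (cyl r (M 0)))
    (adjoint_conj_nonneg hB.1 (cyl r (M 1)))
  refine ⟨h0, (le_iff_qf h0 zero_le_one).2 fun x => ?_⟩
  rw [qf_conj_add hA.1 hB.1, qf_one, ← hM.enorm_cyl_add, ← qf_one, ← qf_one]
  exact add_le_add ((le_iff_qf hA.1 zero_le_one).1 hA.2 _)
    ((le_iff_qf hB.1 zero_le_one).1 hB.2 _)

variable {S : Prog ty} {P : Op ty}

lemma isPredicate_loopSeq (hM : IsMeasurement M) (hS : WlpSpec S) (hP : IsPredicate P) (k : ℕ) :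
    IsPredicate (loopSeq r M S P k) := by
  induction k with
  | zero => exact isPredicate_one
  | succ k ih => exact isPredicate_conj_add hM hP (hS _ ih).1

/-- The start `P₀ = I` is the largest predicate, and monotonicity of `wlp S` propagates the first
inequality. -/
lemma antitone_loopSeq (hM : IsMeasurement M) (hS : WlpSpec S) (hP : IsPredicate P) :
    Antitone (loopSeq r M S P) := by
  have hp := isPredicate_loopSeq hM hS hP
  refine antitone_nat_of_succ_le fun k => ?_
  induction k with
  | zero => exact (hp 1).2
  | succ k ih =>
    refine (le_iff_qf (hp _).1 (hp _).1).2 fun x => ?_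
    have hle : wlp S (loopSeq r M S P (k + 1)) ≤ wlp S (loopSeq r M S P k) :=
      (hS _ (hp (k + 1))).2.mono hS.traceNonincreasing (hp _) (hS _ (hp _)).1 (hS _ (hp _)).1
        (hS _ (hp k)).2 ih
    have hqf : ∀ j, qf (loopSeq r M S P (j + 1)) x =
        qf P (cyl r (M 0) x) + qf (wlp S (loopSeq r M S P j)) (cyl r (M 1) x) := fun j =>
      qf_conj_add hP.1 (hS _ (hp j)).1.1 _ _ x
    rw [hqf, hqf]
    exact add_le_add le_rfl ((le_iff_qf (hS _ (hp _)).1.1 (hS _ (hp _)).1.1).1 hle _)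

/-- This is the trace identity with runs of `k` or more iterations regarded as nonterminating. At `k
= 0` both sums are empty, which forces `P₀ = I`: unfinished runs satisfy any postcondition. -/
lemma etr_loopSeq_add (hM : IsMeasurement M) (hS : WlpSpec S) (hP : IsPredicate P) (k : ℕ)
    {ρ : Op ty} (hρ : IsState ρ) :
    etr (loopSeq r M S P k) ρ + loopSum r M S k ρ (etr 1) =
      loopSum r M S k ρ (etr P) + etr 1 ρ := by
  have hp := isPredicate_loopSeq hM hS hP
  induction k generalizing ρ with
  | zero => simp [loopSeq, loopSum]
  | succ k ih =>
    have hρ₁ : IsState (cyl r (M 1) ∘L ρ ∘L (cyl r (M 1))†) := hρ.conj hM.tsum_enorm_cyl 1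
    have h1 : etr (loopSeq r M S P (k + 1)) ρ =
        etr P (cyl r (M 0) ∘L ρ ∘L (cyl r (M 0))†) +
          etr (wlp S (loopSeq r M S P k)) (cyl r (M 1) ∘L ρ ∘L (cyl r (M 1))†) :=
      etr_conj_add hP.1 (hS _ (hp k)).1.1 hρ.1 _ _
    have h2 : etr 1 ρ = etr 1 (cyl r (M 0) ∘L ρ ∘L (cyl r (M 0))†) +
        etr 1 (cyl r (M 1) ∘L ρ ∘L (cyl r (M 1))†) := by
      rw [etr_one_eq_tsum_conj hM.tsum_enorm_cyl hρ.1, tsum_fintype, Fin.sum_univ_two]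
    rw [h1, h2, loopSum, loopSum]
    have h3 := hS.traceNonincreasing.ne_top hρ₁ isPredicate_one
    have h4 := hS.traceNonincreasing.ne_top hρ₁ (hp k)
    have h5 := (hS _ (hp k)).2 _ hρ₁
    have h6 := hρ₁.outcomeSum_congr (C := some S) fun σ hσ => ih hσ
    rw [outcomeSum_add, outcomeSum_add] at h6
    rw [add_add_add_comm, ennreal_add_eq_add_of_cancel h3 h4 h5 h6, add_add_add_comm]

/-- The strong limit serves twice: traces pass to the limit along it, and since the Löwner order is
closed under strong limits it is also the greatest lower bound. -/
lemma exists_loop (hM : IsMeasurement M) (hS : WlpSpec S) (hP : IsPredicate P) :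
    ∃ W, IsPredicate W ∧ TraceIdentity (.loop r M hM S) P W ∧
      IsGLB (Set.range (loopSeq r M S P)) W := by
  have hp := isPredicate_loopSeq hM hS hP
  obtain ⟨W, h0, h1, hW⟩ := exists_tendsto_of_antitone (antitone_loopSeq hM hS hP)
    (fun k => (hp k).1) (fun k => (hp k).2)
  refine ⟨W, ⟨h0, h1⟩, fun ρ hρ => ?_, ?_, ?_⟩
  · refine tendsto_nhds_unique
      ((tendsto_etr_left hp h0 hρ.1 hρ.2 hW).add (tendsto_loopSum r M hM S ρ (etr 1)))
      (((tendsto_loopSum r M hM S ρ (etr P)).add tendsto_const_nhds).congr fun k => ?_)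
    exact (etr_loopSeq_add hM hS hP k hρ).symm
  · rintro _ ⟨k, rfl⟩
    exact le_of_tendsto_apply ((eventually_ge_atTop k).mono fun j hj =>
      antitone_loopSeq hM hS hP hj) hW
  · exact fun B hB => ge_of_tendsto_apply (.of_forall fun k => hB ⟨k, rfl⟩) hW

end Loop

/-! ### Existence for every program by structural induction -/

lemma exists_init (q : Var) {P : Op ty} (hP : IsPredicate P) :
    ∃ W, IsPredicate W ∧ TraceIdentity (.init q) P W ∧
      ∀ ψ, HasSum (fun k : Val (ty q) => (ketbra q k 0 ∘L P ∘L ketbra q 0 k) ψ) (W ψ) := by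
  obtain ⟨W, h0, h1, hW⟩ := exists_hasSum_conj (tsum_enorm_ketbra (ty := ty) q)
    (W := fun _ => P) fun _ => hP
  refine ⟨W, ⟨h0, h1⟩, traceIdentity_init q hP ⟨h0, h1⟩ hW, ?_⟩
  simpa only [ketbra_adjoint] using hW

lemma exists_measure {n : ℕ} (r : Fin n ↪ Var) {ι : Type} (M : ι → RegOp ty r)
    (hM : IsMeasurement M) (S : ι → Prog ty) (hS : ∀ m, WlpSpec (S m)) {P : Op ty}
    (hP : IsPredicate P) :
    ∃ W, IsPredicate W ∧ TraceIdentity (.measure r M hM S) P W ∧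
      ∀ ψ, HasSum (fun m => ((cyl r (M m))† ∘L wlp (S m) P ∘L cyl r (M m)) ψ) (W ψ) := by
  obtain ⟨W, h0, h1, hW⟩ := exists_hasSum_conj hM.tsum_enorm_cyl
    (W := fun m => wlp (S m) P) fun m => (hS m P hP).1
  exact ⟨W, ⟨h0, h1⟩, traceIdentity_measure r M hM S (fun m => (hS m P hP).1) ⟨h0, h1⟩
    (fun m => (hS m P hP).2) hW, hW⟩

lemma isPredicate_conj_unitary {n : ℕ} (r : Fin n ↪ Var) (U : RegOp ty r) (hU : U† ∘L U = 1)
    {P : Op ty} (hP : IsPredicate P) : IsPredicate ((cyl r U)† ∘L P ∘L cyl r U) := by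
  have h0 := adjoint_conj_nonneg hP.1 (cyl r U)
  refine ⟨h0, (le_iff_qf h0 zero_le_one).2 fun x => ?_⟩
  rw [qf_conj, qf_one, ← enorm_cyl_of_isometry hU, ← qf_one]
  exact (le_iff_qf hP.1 zero_le_one).1 hP.2 _

lemma wlpSpec (S : Prog ty) : WlpSpec S := by
  induction S with
  | skip => exact wlpSpec_of_exists fun P hP => ⟨P, hP, traceIdentity_skip P⟩
  | init q => exact wlpSpec_of_exists fun P hP => (exists_init q hP).imp fun W h => ⟨h.1, h.2.1⟩
  | unitary r U hU =>
    exact wlpSpec_of_exists fun P hP =>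
      ⟨_, isPredicate_conj_unitary r U hU hP, traceIdentity_unitary r U hU hP⟩
  | seq S₁ S₂ ih₁ ih₂ =>
    refine wlpSpec_of_exists fun P hP => ?_
    have h₂ := ih₂ P hP
    have h₁ := ih₁ _ h₂.1
    exact ⟨_, h₁.1, h₁.2.seq ih₁.traceNonincreasing h₂.1 h₂.2⟩
  | measure r M hM S ih =>
    exact wlpSpec_of_exists fun P hP =>
      (exists_measure r M hM S ih hP).imp fun W h => ⟨h.1, h.2.1⟩
  | loop r M hM S ih =>
    exact wlpSpec_of_exists fun P hP => (exists_loop hM ih hP).imp fun W h => ⟨h.1, h.2.1⟩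

lemma TraceIdentity.wlp_eq {S : Prog ty} {P W : Op ty} (hP : IsPredicate P) (hW : IsPredicate W)
    (h : TraceIdentity S P W) : wlp S P = W :=
  (h.isWlp (wlpSpec S).traceNonincreasing hP hW).wlp_eq

lemma isWlp_wlp (S : Prog ty) {P : Op ty} (hP : IsPredicate P) : IsWlp S P (wlp S P) :=
  (wlpSpec S P hP).2.isWlp (wlpSpec S).traceNonincreasing hP (wlpSpec S P hP).1

lemma hasSum_wlp_init (q : Var) {P : Op ty} (hP : IsPredicate P) (ψ : Hall ty) :
    HasSum (fun k : Val (ty q) => (ketbra q k 0 ∘L P ∘L ketbra q 0 k) ψ)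
      (wlp (.init q) P ψ) := by
  obtain ⟨W, hW, h, hs⟩ := exists_init q hP
  rw [h.wlp_eq hP hW]
  exact hs ψ

end TraceIdentity

end QuantumProg

end

open QuantumProg in
theorem mainTheorem6 {Var : Type*} [Countable Var] [Infinite Var] (ty : Var → QType) :
    -- existence and uniqueness of the weakest liberal precondition
    (∀ (S : Prog ty) (P : Op ty), IsPredicate P →
      IsWlp S P (wlp S P) ∧ ∀ W : Op ty, IsWlp S P W → W = wlp S P) ∧
    -- skip
    (∀ P : Op ty, IsPredicate P → wlp Prog.skip P = P) ∧
    -- initialization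
    (∀ (q : Var) (P : Op ty), IsPredicate P → ty q = QType.boolean →
      wlp (Prog.init q) P =
        ketbra q 0 0 ∘L P ∘L ketbra q 0 0 + ketbra q 1 0 ∘L P ∘L ketbra q 0 1) ∧
    (∀ (q : Var) (P : Op ty), IsPredicate P → ty q = QType.integer →
      ∀ ψ : Hall ty, HasSum (fun k : Val (ty q) => (ketbra q k 0 ∘L P ∘L ketbra q 0 k) ψ)
        (wlp (Prog.init q) P ψ)) ∧
    -- unitary transformation
    (∀ {n : ℕ} (r : Fin n ↪ Var) (U : RegOp ty r) (hU : U† ∘L U = 1) (P : Op ty),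
      IsPredicate P → wlp (Prog.unitary r U hU) P = (cyl r U)† ∘L P ∘L cyl r U) ∧
    -- sequential composition
    (∀ (S₁ S₂ : Prog ty) (P : Op ty), IsPredicate P →
      wlp (Prog.seq S₁ S₂) P = wlp S₁ (wlp S₂ P)) ∧
    -- measurement, the sum being taken in the strong operator topology
    (∀ {n : ℕ} (r : Fin n ↪ Var) {ι : Type} (M : ι → RegOp ty r) (hM : IsMeasurement M)
      (S : ι → Prog ty) (P : Op ty), IsPredicate P →
      ∀ ψ : Hall ty,
        HasSum (fun m => ((cyl r (M m))† ∘L wlp (S m) P ∘L cyl r (M m)) ψ)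
          (wlp (Prog.measure r M hM S) P ψ)) ∧
    -- loop, the infimum being taken in the Löwner order
    (∀ {n : ℕ} (r : Fin n ↪ Var) (M : Fin 2 → RegOp ty r) (hM : IsMeasurement M)
      (S : Prog ty) (P : Op ty), IsPredicate P →
      (∀ k, IsPredicate (loopSeq r M S P k)) ∧ Antitone (loopSeq r M S P) ∧
        IsGLB (Set.range (loopSeq r M S P)) (wlp (Prog.loop r M hM S) P)) ∧
    -- the trace identity
    (∀ (S : Prog ty) (P ρ : Op ty), IsPredicate P → IsPartialDensity ρ →
      trace (wlp S P ∘L ρ) =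
        trace (P ∘L sem S ρ) + (trace ρ - trace (sem S ρ))) := by
  refine ⟨fun S P hP => ⟨isWlp_wlp S hP, fun W hW => hW.unique (isWlp_wlp S hP)⟩,
    fun P hP => (traceIdentity_skip P).wlp_eq hP hP, fun q P hP hq => ?_,
    fun q P hP _ ψ => hasSum_wlp_init q hP ψ,
    fun r U hU P hP => (traceIdentity_unitary r U hU hP).wlp_eq hP
      (isPredicate_conj_unitary r U hU hP),
    fun S₁ S₂ P hP => ?_, fun r ι M hM S P hP ψ => ?_, fun r M hM S P hP => ?_,
    fun S P ρ hP hρ => (wlpSpec S P hP).2.trace_eq (wlpSpec S).traceNonincreasing hP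
      (wlpSpec S P hP).1 hρ.isState⟩
  · ext1 ψ
    -- For a Boolean variable the general strong sum over values has just the terms at `0` and `1`.
    exact (hasSum_wlp_init q hP ψ).unique (hasSum_val_boolean hq _)
  · have h₂ := wlpSpec S₂ P hP
    have h₁ := wlpSpec S₁ _ h₂.1
    exact (h₁.2.seq (wlpSpec S₁).traceNonincreasing h₂.1 h₂.2).wlp_eq hP h₁.1
  · obtain ⟨W, hW, h, hs⟩ := exists_measure r M hM S (fun m => wlpSpec (S m)) hP
    rw [h.wlp_eq hP hW]
    exact hs ψ
  · obtain ⟨W, hW, h, hglb⟩ := exists_loop hM (wlpSpec S) hP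
    rw [h.wlp_eq hP hW]
    exact ⟨isPredicate_loopSeq hM (wlpSpec S) hP, antitone_loopSeq hM (wlpSpec S) hP, hglb⟩
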